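/- Let $K$ be a field of characteristic $0$ and let $\epsilon\in\{1,-1\}$. Let $U$ be the universal enveloping algebra of the color Lie algebra $A1_\epsilon$: the associative unital $K$-algebra generated by $H=Q_0,Q_1,Q_2,Q_3$ with relations $$[H,Q_k]=0\ (k=1,2,3),\quad \{Q_1,Q_2\}=Q_3,\quad \{Q_2,Q_3\}=\epsilon Q_1,\quad \{Q_3,Q_1\}=Q_2 .$$ Give $Q_0,Q_1,Q_2,Q_3$ the degrees $(0,0),(1,0),(0,1),(1,1)\in\mathbb Z_2\times\mathbb Z_2$, put $\sigma(\mu,\nu)=(-1)^{\alpha_1\beta_2-\alpha_2\beta_1}$ where $\alpha,\beta$ are the degrees of $Q_\mu,Q_\nu$, and let $C=B^{-1}$ where $B=\mathrm{diag}(1,\epsilon,1,1)$. Put $$c=\sum_{\mu,\nu}C^{\mu\nu}Q_\mu Q_\nu=H^2+\epsilon Q_1^2+Q_2^2+Q_3^2,\qquad y=c-H^2 ;$$ both are central in $U$. Let $D$ be a chord diagram of order $n\ge 0$ ($n$ chords with $2n$ distinct endpoints on an oriented circle, up to orientation-preserving homeomorphism). Cut the circle at a point other than an endpoint and number the endpoints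 $1,\dots,2n$ along the resulting line. The weight of the cut diagram is $$w(D)=\sum_{x:\{1,\dots,2n\}\to\{0,1,2,3\}}\Big(\prod_{\text{chords }\{i<j\}}C^{x_i x_j}\Big)\Big(\prod_{\text{crossings}}\sigma(x_k,x_j)\Big)\,Q_{x_1}Q_{x_2}\cdots Q_{x_{2n}}\in U,$$ where the second product is over all pairs of chords $\{i,k\},\{j,l\}$ with $i<j<k<l$. Extend $w$ linearly to formal linear combinations of chord diagrams, and let $s(D)=\sum_a (D-a)$, the sum over all chords $a$ of $D$ of the diagram with $a$ removed (so $s(D)=0$ if $n=0$). Then $w(D)$ does not depend on the cut, there is a unique polynomial $P_D\in K[c,y]$ in two variables whose value at the central elements $c,y$ is $w(D)$, and, with $\partial/\partial c$ the partial derivative of this polynomial at fixed $y$, $$\frac{\partial}{\partial c}\,w(D)=w(s(D)),$$ that is, the value of $\partial P_D/\partial c$ at the elements $c,y$ is $w(s(D))$. -/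

import Mathlib

/-! ### The color Lie algebra `A1_ε` and its universal enveloping algebra -/

namespace A1

/-- The `ℤ₂ × ℤ₂`-degree of the basis vectors `Q₀ = H, Q₁, Q₂, Q₃`. -/
def deg : Fin 4 → ZMod 2 × ZMod 2 := ![(0, 0), (1, 0), (0, 1), (1, 1)]

/-- The commuting factor `(-1)^(α₁β₂ - α₂β₁)` of `ℤ₂ × ℤ₂`-graded Lie algebras, evaluated at the
degrees of two basis vectors. -/
def commFactor (K : Type*) [Field K] (μ ν : Fin 4) : K :=
  (-1) ^ ((deg μ).1 * (deg ν).2 - (deg μ).2 * (deg ν).1).val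

/-- The structure constants `f_{μν}^ρ` of `A1_ε`: the nonzero graded brackets of basis vectors are
`{Q₁, Q₂} = Q₃`, `{Q₂, Q₃} = ε Q₁`, `{Q₃, Q₁} = Q₂`. -/
def structConst (K : Type*) [Field K] (ε : ℤˣ) : Fin 4 → Fin 4 → Fin 4 → K
  | 1, 2, 3 => 1
  | 2, 1, 3 => 1
  | 2, 3, 1 => ((ε : ℤ) : K)
  | 3, 2, 1 => ((ε : ℤ) : K)
  | 3, 1, 2 => 1
  | 1, 3, 2 => 1
  | _, _, _ => 0

/-- The invariant bilinear form `B = diag(1, ε, 1, 1)` in the basis `Q₀, Q₁, Q₂, Q₃`. -/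
def form (K : Type*) [Field K] (ε : ℤˣ) : Matrix (Fin 4) (Fin 4) K :=
  Matrix.diagonal ![1, ((ε : ℤ) : K), 1, 1]

/-- The inverse `C` of the invariant bilinear form. -/
noncomputable def formInv (K : Type*) [Field K] (ε : ℤˣ) : Matrix (Fin 4) (Fin 4) K :=
  (form K ε)⁻¹

/-- The defining relations `X Y = S(X, Y) + f(X, Y)` of the enveloping algebra, for basis
vectors `X = Q_μ`, `Y = Q_ν`, where `S(Q_μ, Q_ν) = commFactor μ ν • Q_ν ⊗ Q_μ`. -/
inductive Rel (K : Type*) [Field K] (ε : ℤˣ) :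
    FreeAlgebra K (Fin 4) → FreeAlgebra K (Fin 4) → Prop
  | mul (μ ν : Fin 4) : Rel K ε (FreeAlgebra.ι K μ * FreeAlgebra.ι K ν)
      (commFactor K μ ν • (FreeAlgebra.ι K ν * FreeAlgebra.ι K μ)
        + ∑ ρ, structConst K ε μ ν ρ • FreeAlgebra.ι K ρ)

/-- The universal enveloping algebra `U(A1_ε)`; the free algebra on `Q₀, …, Q₃` is the tensor
algebra of the underlying four-dimensional space. -/
abbrev Env (K : Type*) [Field K] (ε : ℤˣ) : Type _ := RingQuot (Rel K ε)

/-- The generators `Q₀ = H, Q₁, Q₂, Q₃` of `U(A1_ε)`. -/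
noncomputable def Q (K : Type*) [Field K] (ε : ℤˣ) (μ : Fin 4) : Env K ε :=
  RingQuot.mkAlgHom K (Rel K ε) (FreeAlgebra.ι K μ)

/-- The Casimir element `c = ∑ C^{μν} Q_μ Q_ν`, as an element of `U(A1_ε)`. -/
noncomputable def casimirElt (K : Type*) [Field K] (ε : ℤˣ) : Env K ε :=
  ∑ μ, ∑ ν, formInv K ε μ ν • (Q K ε μ * Q K ε ν)

theorem Q_mul_Q (K : Type*) [Field K] (ε : ℤˣ) (μ ν : Fin 4) :
    Q K ε μ * Q K ε ν = commFactor K μ ν • (Q K ε ν * Q K ε μ)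
      + ∑ ρ, structConst K ε μ ν ρ • Q K ε ρ := by
  have h := RingQuot.mkAlgHom_rel K (Rel.mul (K := K) (ε := ε) μ ν)
  simpa [Q, map_sum] using h

theorem sign_sq (K : Type*) [Field K] (ε : ℤˣ) : ((ε : ℤ) : K) * ((ε : ℤ) : K) = 1 := by
  rcases Int.units_eq_one_or ε with rfl | rfl <;> simp

theorem formInv_eq (K : Type*) [Field K] (ε : ℤˣ) : formInv K ε = form K ε := by
  refine Matrix.inv_eq_left_inv ?_
  rw [form, Matrix.diagonal_mul_diagonal, ← Matrix.diagonal_one]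
  congr 1
  funext i
  fin_cases i <;> simp [sign_sq]

theorem casimirElt_eq (K : Type*) [Field K] (ε : ℤˣ) :
    casimirElt K ε = Q K ε 0 * Q K ε 0 + ((ε : ℤ) : K) • (Q K ε 1 * Q K ε 1)
      + Q K ε 2 * Q K ε 2 + Q K ε 3 * Q K ε 3 := by
  simp [casimirElt, formInv_eq, form, Fin.sum_univ_four, Matrix.diagonal_apply]

/-- An element commuting with all generators is central. -/
theorem mem_center_of_commute (K : Type*) [Field K] (ε : ℤˣ) (z : Env K ε)
    (h : ∀ μ, Q K ε μ * z = z * Q K ε μ) : z ∈ Subalgebra.center K (Env K ε) := by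
  rw [Subalgebra.mem_center_iff]
  intro b
  obtain ⟨a, rfl⟩ := RingQuot.mkAlgHom_surjective K (Rel K ε) b
  induction a using FreeAlgebra.induction with
  | grade0 r => simpa using Algebra.commutes r z
  | grade1 μ => exact h μ
  | mul a b ha hb => rw [map_mul, mul_assoc, hb, ← mul_assoc, ha, mul_assoc]
  | add a b ha hb => rw [map_add, add_mul, mul_add, ha, hb]

theorem Q_zero_commute (K : Type*) [Field K] (ε : ℤˣ) (μ : Fin 4) :
    Q K ε μ * Q K ε 0 = Q K ε 0 * Q K ε μ := by
  rw [Q_mul_Q]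
  fin_cases μ <;> simp [commFactor, deg, structConst]

theorem sq_Q_zero_mem_center (K : Type*) [Field K] (ε : ℤˣ) :
    Q K ε 0 ^ 2 ∈ Subalgebra.center K (Env K ε) :=
  pow_mem (mem_center_of_commute K ε _ (Q_zero_commute K ε)) 2

theorem anticomm (K : Type*) [Field K] (ε : ℤˣ) :
    (Q K ε 1 * Q K ε 2 = Q K ε 3 - Q K ε 2 * Q K ε 1) ∧
    (Q K ε 2 * Q K ε 1 = Q K ε 3 - Q K ε 1 * Q K ε 2) ∧
    (Q K ε 2 * Q K ε 3 = ((ε : ℤ) : K) • Q K ε 1 - Q K ε 3 * Q K ε 2) ∧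
    (Q K ε 3 * Q K ε 2 = ((ε : ℤ) : K) • Q K ε 1 - Q K ε 2 * Q K ε 3) ∧
    (Q K ε 3 * Q K ε 1 = Q K ε 2 - Q K ε 1 * Q K ε 3) ∧
    (Q K ε 1 * Q K ε 3 = Q K ε 2 - Q K ε 3 * Q K ε 1) := by
  have h1 : (1 : ZMod 2).val = 1 := rfl
  refine ⟨?_, ?_, ?_, ?_, ?_, ?_⟩
  · rw [Q_mul_Q K ε 1 2]
    simp [commFactor, deg, structConst, Fin.sum_univ_four, h1]; module
  · rw [Q_mul_Q K ε 2 1]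
    simp [commFactor, deg, structConst, Fin.sum_univ_four, h1]; module
  · rw [Q_mul_Q K ε 2 3]
    simp [commFactor, deg, structConst, Fin.sum_univ_four, h1]; module
  · rw [Q_mul_Q K ε 3 2]
    simp [commFactor, deg, structConst, Fin.sum_univ_four, h1]; module
  · rw [Q_mul_Q K ε 3 1]
    simp [commFactor, deg, structConst, Fin.sum_univ_four, h1]; module
  · rw [Q_mul_Q K ε 1 3]
    simp [commFactor, deg, structConst, Fin.sum_univ_four, h1]; module

theorem mul_sq_of_anticomm {R : Type*} [Ring R] {a b t : R} (h : a * b = t - b * a) :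
    a * (b * b) = b * b * a + (t * b - b * t) := by
  rw [← mul_assoc, h, sub_mul, mul_assoc b a b, h]
  noncomm_ring

theorem casimirElt_mem_center (K : Type*) [Field K] (ε : ℤˣ) :
    casimirElt K ε ∈ Subalgebra.center K (Env K ε) := by
  refine mem_center_of_commute K ε _ fun μ => ?_
  obtain ⟨h12, h21, h23, h32, h31, h13⟩ := anticomm K ε
  have h0 : Q K ε μ * (Q K ε 0 * Q K ε 0) = Q K ε 0 * Q K ε 0 * Q K ε μ := by
    rw [← mul_assoc, Q_zero_commute, mul_assoc, Q_zero_commute, mul_assoc]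
  rw [casimirElt_eq, mul_add, mul_add, mul_add, add_mul, add_mul, add_mul, h0, mul_smul_comm,
    smul_mul_assoc]
  fin_cases μ
  · have hc : ∀ ν, Q K ε 0 * (Q K ε ν * Q K ε ν) = Q K ε ν * Q K ε ν * Q K ε 0 := fun ν => by
      rw [← mul_assoc, ← Q_zero_commute, mul_assoc, ← Q_zero_commute, mul_assoc]
    simp [hc]
  · simp only [Fin.mk_one]
    rw [mul_sq_of_anticomm h12, mul_sq_of_anticomm h13, mul_assoc (Q K ε 1)]
    abel
  · simp only [Fin.reduceFinMk]
    rw [mul_sq_of_anticomm h21, mul_sq_of_anticomm h23, mul_assoc (Q K ε 2), smul_mul_assoc,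
      mul_smul_comm, smul_add, smul_sub]
    abel
  · simp only [Fin.reduceFinMk]
    rw [mul_sq_of_anticomm h31, mul_sq_of_anticomm h32, mul_assoc (Q K ε 3), smul_mul_assoc,
      mul_smul_comm, smul_add, smul_sub]
    abel

/-- The Casimir element `c` in the center of `U(A1_ε)`. -/
noncomputable def casimir (K : Type*) [Field K] (ε : ℤˣ) : Subalgebra.center K (Env K ε) :=
  ⟨casimirElt K ε, casimirElt_mem_center K ε⟩

/-- The central element `y = c - H²`. -/
noncomputable def yElt (K : Type*) [Field K] (ε : ℤˣ) : Subalgebra.center K (Env K ε) :=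
  casimir K ε - ⟨Q K ε 0 ^ 2, sq_Q_zero_mem_center K ε⟩

/-- The value `P(c, y)` in `U(A1_ε)` of a polynomial `P` in two variables; variable `0` stands for
`c` and variable `1` for `y`. -/
noncomputable def evalCY (K : Type*) [Field K] (ε : ℤˣ) (P : MvPolynomial (Fin 2) K) : Env K ε :=
  (MvPolynomial.aeval ![casimir K ε, yElt K ε] P : Subalgebra.center K (Env K ε))

end A1

/-! ### Chord diagrams -/

/-- A chord diagram of order `n` cut open at a point of the circle: its `2n` endpoints are numbered
along the line, and `partner` exchanges the two ends of each chord. -/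
@[ext] structure CutDiagram (n : ℕ) where
  partner : Fin (2 * n) → Fin (2 * n)
  partner_partner : ∀ i, partner (partner i) = i
  partner_ne : ∀ i, partner i ≠ i

namespace CutDiagram

variable {n : ℕ}

/-- Two cut diagrams come from the same chord diagram on the oriented circle if a bijection of the
endpoints preserves the cyclic order and the chords. -/
def CircleIso (L L' : CutDiagram n) : Prop :=
  ∃ e : Equiv.Perm (Fin (2 * n)),
    (∀ a b c, sbtw (e a) (e b) (e c) ↔ sbtw a b c) ∧ ∀ i, e (L.partner i) = L'.partner (e i)

instance setoid (n : ℕ) : Setoid (CutDiagram n) where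
  r := CircleIso
  iseqv :=
    { refl := fun L => ⟨Equiv.refl _, fun _ _ _ => Iff.rfl, fun _ => rfl⟩
      symm := by
        rintro L L' ⟨e, h, hp⟩
        refine ⟨e.symm, fun a b c => ?_, fun i => ?_⟩
        · rw [← h]; simp
        · rw [Equiv.symm_apply_eq, hp]; simp
      trans := by
        rintro L L' L'' ⟨e, h, hp⟩ ⟨e', h', hp'⟩
        refine ⟨e.trans e', fun a b c => ?_, fun i => ?_⟩
        · simp [h, h']
        · simp [hp, hp'] }

/-- The chords, each represented by its first endpoint on the line. -/
def chords (L : CutDiagram n) : Finset (Fin (2 * n)) :=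
  Finset.univ.filter fun i => i < L.partner i

/-- The endpoints which remain when the chord through `i` is removed. -/
def kept (L : CutDiagram n) (i : Fin (2 * n)) : Finset (Fin (2 * n)) :=
  Finset.univ.filter fun j => j ≠ i ∧ j ≠ L.partner i

theorem mem_kept (L : CutDiagram n) (i j : Fin (2 * n)) :
    j ∈ L.kept i ↔ j ≠ i ∧ j ≠ L.partner i := by
  simp [kept]

theorem partner_eq_iff (L : CutDiagram n) (i j : Fin (2 * n)) :
    L.partner i = j ↔ i = L.partner j :=
  ⟨fun h => by rw [← h, L.partner_partner], fun h => by rw [h, L.partner_partner]⟩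

theorem partner_mem_kept (L : CutDiagram n) (i j : Fin (2 * n)) (h : j ∈ L.kept i) :
    L.partner j ∈ L.kept i := by
  rw [mem_kept] at h ⊢
  refine ⟨fun h' => h.2 ((L.partner_eq_iff _ _).1 h'), fun h' => h.1 ?_⟩
  rw [← L.partner_partner j, h', L.partner_partner]

theorem card_kept (L : CutDiagram n) (i : Fin (2 * n)) : (L.kept i).card = 2 * (n - 1) := by
  have h : L.kept i = Finset.univ \ {i, L.partner i} := by
    ext j; simp [mem_kept]
  rw [h, Finset.card_sdiff_of_subset (Finset.subset_univ _), Finset.card_pair (L.partner_ne i).symm]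
  simp
  omega

/-- The remaining endpoints, renumbered along the line. -/
def keptIso (L : CutDiagram n) (i : Fin (2 * n)) : Fin (2 * (n - 1)) ≃o L.kept i :=
  (L.kept i).orderIsoOfFin (L.card_kept i)

/-- The cut diagram without the chord through `i`. -/
def delete (L : CutDiagram n) (i : Fin (2 * n)) : CutDiagram (n - 1) where
  partner j := (L.keptIso i).symm
    ⟨L.partner (L.keptIso i j), L.partner_mem_kept i _ (L.keptIso i j).2⟩
  partner_partner j := by simp [L.partner_partner]
  partner_ne j h := by
    rw [OrderIso.symm_apply_eq, Subtype.ext_iff] at h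
    exact L.partner_ne _ h

end CutDiagram

/-- Chord diagrams of order `n` on the oriented circle. -/
def ChordDiagram (n : ℕ) : Type := Quotient (CutDiagram.setoid n)

/-- The chord diagram obtained by closing up the line to the circle. -/
def CutDiagram.close {n : ℕ} (L : CutDiagram n) : ChordDiagram n := Quotient.mk _ L

namespace CutDiagram

variable {n : ℕ}

theorem sbtw_coe_keptIso (L : CutDiagram n) (i : Fin (2 * n)) (a b c : Fin (2 * (n - 1))) :
    sbtw (L.keptIso i a : Fin (2 * n)) (L.keptIso i b) (L.keptIso i c) ↔ sbtw a b c := by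
  have h : ∀ a b, (L.keptIso i a : Fin (2 * n)) < L.keptIso i b ↔ a < b := fun a b => by
    rw [Subtype.coe_lt_coe, OrderIso.lt_iff_lt]
  change (_ ∨ _ ∨ _) ↔ (_ ∨ _ ∨ _)
  simp only [h]

theorem close_delete_eq {L L' : CutDiagram n} (e : Equiv.Perm (Fin (2 * n)))
    (h : ∀ a b c, sbtw (e a) (e b) (e c) ↔ sbtw a b c)
    (hp : ∀ i, e (L.partner i) = L'.partner (e i)) (i i' : Fin (2 * n))
    (hi : e i = i' ∨ e i = L'.partner i') :
    (L.delete i).close = (L'.delete i').close := by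
  have hk : ∀ j, j ∈ L.kept i ↔ e j ∈ L'.kept i' := fun j => by
    rw [mem_kept, mem_kept]
    rcases hi with hi | hi
    · rw [← hi, ← hp, e.injective.ne_iff, e.injective.ne_iff]
    · have hi' : i' = e (L.partner i) := by rw [hp, hi, L'.partner_partner]
      rw [← hi, hi', e.injective.ne_iff, e.injective.ne_iff, and_comm]
  refine Quotient.sound ⟨((L.keptIso i).toEquiv.trans (e.subtypeEquiv hk)).trans
    (L'.keptIso i').symm.toEquiv, fun a b c => ?_, fun j => ?_⟩
  · rw [← L'.sbtw_coe_keptIso i', ← L.sbtw_coe_keptIso i]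
    simp [h]
  · simp [delete, hp]

/-- The sum of the diagrams with one chord removed, over all chords. -/
noncomputable def removeSum (K : Type*) [Field K] (L : CutDiagram n) : ChordDiagram (n - 1) →₀ K :=
  ∑ i ∈ L.chords, Finsupp.single (L.delete i).close 1

theorem removeSum_eq_of_iso (K : Type*) [Field K] (L L' : CutDiagram n) (hL : CircleIso L L') :
    L.removeSum K = L'.removeSum K := by
  obtain ⟨e, h, hp⟩ := hL
  have key : ∀ (M : CutDiagram n) (i : Fin (2 * n)), min i (M.partner i) ∈ M.chords ∧
      (min i (M.partner i) = i ∨ min i (M.partner i) = M.partner i) := fun M i => by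
    rcases lt_or_gt_of_ne (M.partner_ne i) with hlt | hlt
    · rw [min_eq_right hlt.le]
      simp [chords, M.partner_partner, hlt]
    · rw [min_eq_left hlt.le]
      simp [chords, hlt]
  have uniq : ∀ (M : CutDiagram n) (i j : Fin (2 * n)), i ∈ M.chords → (j = i ∨ j = M.partner i) →
      min j (M.partner j) = i := fun M i j hi hj => by
    have hi' : i < M.partner i := by simpa [chords] using hi
    rcases hj with rfl | rfl
    · exact min_eq_left hi'.le
    · rw [M.partner_partner]; exact min_eq_right hi'.le
  refine Finset.sum_bij' (fun i _ => min (e i) (L'.partner (e i)))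
    (fun i _ => min (e.symm i) (L.partner (e.symm i))) (fun i _ => (key L' _).1)
    (fun i _ => (key L _).1) (fun i hi => ?_) (fun i hi => ?_) (fun i hi => ?_)
  · refine uniq L i _ hi ?_
    rcases (key L' (e i)).2 with h' | h' <;> rw [h']
    · simp
    · right; rw [← hp]; simp
  · refine uniq L' i _ hi ?_
    rcases (key L (e.symm i)).2 with h' | h' <;> rw [h']
    · simp
    · right; rw [hp]; simp
  · congr 1
    refine close_delete_eq e h hp _ _ ?_
    rcases (key L' (e i)).2 with h' | h' <;> rw [h']
    · simp
    · right; rw [L'.partner_partner]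

/-- The weight of a cut diagram: the basis vectors attached to the endpoints are multiplied along the
line and summed over all labellings `x` of the endpoints. A chord with ends `i < j` contributes
`C^{x i, x j}`, and a crossing of chords with ends `i < j < partner i < partner j` contributes the
commuting factor of the map `S`. -/
noncomputable def weight (K : Type*) [Field K] (ε : ℤˣ) (L : CutDiagram n) : A1.Env K ε :=
  ∑ x : Fin (2 * n) → Fin 4,
    ((∏ i ∈ L.chords, A1.formInv K ε (x i) (x (L.partner i)))
      * ∏ p : Fin (2 * n) × Fin (2 * n) with
          p.1 < p.2 ∧ p.2 < L.partner p.1 ∧ L.partner p.1 < L.partner p.2,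
        A1.commFactor K (x (L.partner p.1)) (x p.2))
      • (List.ofFn fun i => A1.Q K ε (x i)).prod

end CutDiagram

namespace ChordDiagram

variable {n : ℕ}

/-- The sum `s(D)` of the diagrams `D - a` over all chords `a` of `D`, as a formal linear
combination of chord diagrams; it is `0` if `D` has no chord. -/
noncomputable def s (K : Type*) [Field K] (D : ChordDiagram n) : ChordDiagram (n - 1) →₀ K :=
  Quotient.lift (CutDiagram.removeSum K) (CutDiagram.removeSum_eq_of_iso K) D

/-- The weight `w(D)`, computed at some cut of `D`. -/
noncomputable def weight (K : Type*) [Field K] (ε : ℤˣ) (D : ChordDiagram n) : A1.Env K ε :=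
  (Quotient.out D).weight K ε

/-- The linear extension of the weight to formal linear combinations of chord diagrams. -/
noncomputable def weightLin (K : Type*) [Field K] (ε : ℤˣ) :
    (ChordDiagram n →₀ K) →ₗ[K] A1.Env K ε :=
  Finsupp.linearCombination K (weight K ε)

end ChordDiagram

/-! The signs can be absorbed into matrices. The matrices t_a (`twist`) in M₂(K) commute up to
exactly the commuting factor σ, and their squares are scalars. Hence graded brackets of the Q_a
become ordinary commutators of the Q_a ⊗ t_a in U ⊗ M₂(K), and these satisfy the relations of sl₂
together with a central element Q_0 ⊗ 1 (`isSl2Family_twistedQ`). Along a labelling constant on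
chords, the product of the t's is one square per chord times the signs of the crossings
(`prod_eq_crossings`). So w(D) ⊗ 1 is a weight without signs, for the form diag(1, ε, ε, -ε)
(`CutDiagram.weight_tmul_one`), and a ↦ a ⊗ 1 loses nothing.

For the sign-free weight the usual Lie-algebraic arguments apply: invariance of ∑ g_b J_b ⊗ J_b
makes it central (`plainWeight_commute`) and independent of the cut (`plainWeight_rotate`). The
universal case is U(sl₂)[X], where X plays the role of H and c = X² + y, with y equal to ε times the
Casimir element. At fixed y, d/dX is 2X ∂/∂c. By the Leibniz rule, d/dX replaces one end of a chord
labelled 0 by 1 and leaves a central factor X at the other end. Each chord has two ends, so dW/dX =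
2X ∑ W(D - a) (`CutDiagram.derivation_plainWeight`); cancelling 2X gives the formula.

That W is a polynomial in c and y follows by induction on the number of chords: subtracting an
antiderivative in c of the sum for the smaller diagrams leaves something free of X, which is central
in U(sl₂) and so a polynomial in the Casimir element (`Sl2Env.exists_aeval_casimir`, proved by a PBW
spanning set and Verma modules). A homomorphism U(sl₂)[X] → U ⊗ M₂(K) carries the result back
(`exists_polyLift_twistedQ`). Uniqueness is algebraic independence of c and y, seen in the opposite
direction through U → U(sl₂)[X] ⊗ M₂(K) (`evalCY_injective`). -/

/-! ### Ordered products in a noncommutative ring. -/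

namespace OrderedProd

variable {K A : Type*} [Field K] [Ring A] [Algebra K A]

theorem update_zero_comp_succ {B : Type*} {m : ℕ} (f : Fin (m + 1) → B) (v : B) :
    (fun i : Fin m => Function.update f 0 v i.succ) = fun i => f i.succ := by
  funext i
  simp

theorem update_succ_comp_succ {B : Type*} {m : ℕ} (f : Fin (m + 1) → B) (j : Fin m) (v : B) :
    (fun i : Fin m => Function.update f j.succ v i.succ)
      = Function.update (fun i => f i.succ) j v := by
  funext i
  by_cases h : i = j
  · subst h; simp
  · simp [Function.update_of_ne h, Function.update_of_ne ((Fin.succ_injective m).ne h)]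

/-- The Leibniz rule for ordered products. -/
theorem leibniz (d : A →+ A) (hd : ∀ a b, d (a * b) = d a * b + a * d b) {m : ℕ}
    (f : Fin m → A) :
    d (List.ofFn f).prod = ∑ i, (List.ofFn (Function.update f i (d (f i)))).prod := by
  induction m with
  | zero =>
    have h := hd 1 1
    simp only [mul_one, one_mul] at h
    simpa using h
  | succ m ih =>
    rw [List.ofFn_succ, List.prod_cons, hd, ih, Fin.sum_univ_succ, Finset.mul_sum]
    congr 1
    · rw [List.ofFn_succ, List.prod_cons, update_zero_comp_succ, Function.update_self]
    · refine Finset.sum_congr rfl fun i _ => ?_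
      rw [List.ofFn_succ, List.prod_cons, update_succ_comp_succ,
        Function.update_of_ne (Fin.succ_ne_zero i).symm]

/-- A central factor can be taken out of an ordered product. -/
theorem central_factor {m : ℕ} (f : Fin m → A) (i : Fin m) (h : ∀ a, f i * a = a * f i) :
    (List.ofFn f).prod = f i * (List.ofFn (Function.update f i 1)).prod := by
  induction m with
  | zero => exact i.elim0
  | succ m ih =>
    rw [List.ofFn_succ, List.prod_cons, List.ofFn_succ, List.prod_cons]
    refine Fin.cases (fun h => ?_) (fun j h => ?_) i h
    · rw [update_zero_comp_succ, Function.update_self, one_mul]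
    · rw [update_succ_comp_succ, Function.update_of_ne (Fin.succ_ne_zero j).symm,
        ih (fun i => f i.succ) j h, ← mul_assoc, ← mul_assoc, h]

theorem prod_eq_one {m : ℕ} (f : Fin m → A) (h : ∀ i, f i = 1) : (List.ofFn f).prod = 1 := by
  refine List.prod_eq_one fun a ha => ?_
  obtain ⟨i, rfl⟩ := (List.mem_ofFn' f a).1 ha
  exact h i

theorem prod_eq_zero {m : ℕ} (f : Fin m → A) (i : Fin m) (h : f i = 0) :
    (List.ofFn f).prod = 0 :=
  List.prod_eq_zero (h ▸ (List.mem_ofFn' f (f i)).2 ⟨i, rfl⟩)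

/-- Splitting an ordered product into two. -/
theorem split {m : ℕ} (f : Fin m → A) (k : ℕ) :
    (List.ofFn f).prod = (List.ofFn fun i : Fin m => if (i : ℕ) < k then f i else 1).prod
      * (List.ofFn fun i : Fin m => if (i : ℕ) < k then 1 else f i).prod := by
  induction m generalizing k with
  | zero => simp
  | succ m ih =>
    cases k with
    | zero => simp
    | succ k => simpa [List.ofFn_succ, mul_assoc] using congrArg (f 0 * ·) (ih (fun i => f i.succ) k)

theorem prod_single {m : ℕ} (f : Fin m → A) (i : Fin m) (h : ∀ j, j ≠ i → f j = 1) :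
    (List.ofFn f).prod = f i := by
  induction m with
  | zero => exact i.elim0
  | succ m ih =>
    rw [List.ofFn_succ, List.prod_cons]
    refine Fin.cases (fun h => ?_) (fun j h => ?_) i h
    · rw [prod_eq_one _ fun i => h _ (Fin.succ_ne_zero i), mul_one]
    · rw [h 0 (Fin.succ_ne_zero j).symm, one_mul]
      exact ih (fun i => f i.succ) j fun i hi => h _ ((Fin.succ_injective m).ne hi)

/-- Splitting off one factor of an ordered product. -/
theorem split_at {m : ℕ} (f : Fin m → A) (i : Fin m) :
    (List.ofFn f).prod = (List.ofFn fun j => if j < i then f j else 1).prod * f i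
      * (List.ofFn fun j => if i < j then f j else 1).prod := by
  rw [split f (i + 1), split (fun j : Fin m => if (j : ℕ) < i + 1 then f j else 1) i]
  congr 2
  · congr 2; funext j
    simp only [Fin.lt_def]
    split_ifs <;> first | rfl | omega
  · rw [prod_single _ i]
    · simp
    · intro j hj
      have := Fin.val_ne_of_ne hj
      split_ifs <;> first | rfl | omega
  · congr 1; funext j
    simp only [Fin.lt_def]
    split_ifs <;> first | rfl | omega

/-- Moving an element past an ordered product of factors with which it commutes up to scalars. -/
theorem move {m : ℕ} (u : A) (s : Fin m → K) (f : Fin m → A)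
    (h : ∀ i, u * f i = s i • (f i * u)) :
    u * (List.ofFn f).prod = (∏ i, s i) • ((List.ofFn f).prod * u) := by
  induction m with
  | zero => simp
  | succ m ih =>
    rw [List.ofFn_succ, List.prod_cons, ← mul_assoc, h, smul_mul_assoc, mul_assoc,
      ih (fun i => s i.succ) _ fun i => h _, mul_smul_comm, smul_smul, Fin.prod_univ_succ, mul_assoc]

theorem prod_filter_of_eq_one {ι : Type*} (l : List ι) (P : ι → Prop) [DecidablePred P]
    (f : ι → A) (h : ∀ i, ¬ P i → f i = 1) : (l.map f).prod = ((l.filter P).map f).prod := by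
  induction l with
  | nil => simp
  | cons a l ih =>
    by_cases ha : P a
    · simp [ha, ih]
    · simp [ha, ih, h a ha]

/-- Factors `1` may be left out of an ordered product. -/
theorem prod_eq_prod_orderIso {m k : ℕ} (S : Finset (Fin m)) (e : Fin k ≃o S) (f : Fin m → A)
    (h : ∀ i, i ∉ S → f i = 1) :
    (List.ofFn f).prod = (List.ofFn fun j => f (e j)).prod := by
  -- Both lists are strictly increasing with the same members, hence equal.
  have hl : (List.finRange m).filter (· ∈ S) = (List.finRange k).map fun j => (e j : Fin m) := by
    refine List.Perm.eq_of_pairwise (le := (· < ·)) (fun a b _ _ h h' => (lt_asymm h h').elim) ?_ ?_ ?_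
    · exact (List.pairwise_lt_finRange m).filter _
    · rw [List.pairwise_map]
      exact (List.pairwise_lt_finRange k).imp fun hab => by simpa using hab
    · refine (List.perm_ext_iff_of_nodup ((List.nodup_finRange m).filter _)
        ((List.nodup_finRange k).map (Subtype.val_injective.comp e.injective))).2 fun a => ?_
      simp only [List.mem_filter, List.mem_finRange, true_and, decide_eq_true_eq, List.mem_map]
      exact ⟨fun ha => ⟨e.symm ⟨a, ha⟩, by simp⟩, by rintro ⟨j, rfl⟩; exact (e j).2⟩
  rw [List.ofFn_eq_map, prod_filter_of_eq_one _ (· ∈ S) f h, hl, List.map_map, List.ofFn_eq_map]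
  rfl

end OrderedProd

/-! ### Weights without signs: centrality and rotation invariance. -/

/-- The coefficient `∏ g(x_i)` over all chords of a labelling `x`. -/
def chordCoeff {K : Type*} [Field K] (g : Fin 4 → K) {m : ℕ} (p : Fin m → Fin m)
    (x : Fin m → Fin 4) : K :=
  ∏ i with i < p i, g (x i)

/-- The labellings of the endpoints which are constant on chords. -/
def chordLabellings {m : ℕ} (p : Fin m → Fin m) : Finset (Fin m → Fin 4) :=
  Finset.univ.filter fun x => ∀ i, x (p i) = x i

/-- The weight of a cut diagram without signs, for a diagonal form `g` and elements `J`. -/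
def plainWeight {K A : Type*} [Field K] [Ring A] [Algebra K A] (g : Fin 4 → K) (J : Fin 4 → A)
    {m : ℕ} (p : Fin m → Fin m) : A :=
  ∑ x ∈ chordLabellings p, chordCoeff g p x • (List.ofFn fun i => J (x i)).prod

/-- The diagonal form for which the weight of `A1_ε` becomes a plain weight. -/
def sl2Form {K : Type*} [Field K] (η : K) : Fin 4 → K := ![1, η, η, -η]

/-- `J₁, J₂, J₃` satisfy the relations of `sl₂` in the basis `h/2, (e+f)/2, (e-f)/2`, and `J₀`
commutes with all elements. -/
structure IsSl2Family {A : Type*} [Ring A] (J : Fin 4 → A) : Prop where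
  central : ∀ a, J 0 * a = a * J 0
  comm12 : J 1 * J 2 - J 2 * J 1 = J 3
  comm23 : J 2 * J 3 - J 3 * J 2 = - J 1
  comm31 : J 3 * J 1 - J 1 * J 3 = - J 2

section

variable {K A A' : Type*} [Field K] [Ring A] [Algebra K A] [Ring A'] [Algebra K A']
  {g : Fin 4 → K} {J : Fin 4 → A} {m : ℕ} {p : Fin m → Fin m}

theorem mem_chordLabellings {x : Fin m → Fin 4} :
    x ∈ chordLabellings p ↔ ∀ i, x (p i) = x i := by
  simp [chordLabellings]

theorem map_plainWeight (φ : A →ₐ[K] A') :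
    φ (plainWeight g J p) = plainWeight g (fun a => φ (J a)) p := by
  simp [plainWeight, map_sum, map_list_prod, List.map_ofFn, Function.comp_def]

/-- The labelling with the label of the chord through `i` replaced by `b`. -/
def relabel (p : Fin m → Fin m) (x : Fin m → Fin 4) (i : Fin m) (b : Fin 4) : Fin m → Fin 4 :=
  Function.update (Function.update x i b) (p i) b

theorem relabel_apply (x : Fin m → Fin 4) (i j : Fin m) (b : Fin 4) :
    relabel p x i b j = if j = i ∨ j = p i then b else x j := by
  unfold relabel
  by_cases h1 : j = p i
  · simp [h1]
  · by_cases h2 : j = i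
    · subst h2; simp [h1]
    · simp [h1, h2]

theorem relabel_mem (hp : ∀ i, p (p i) = i) {x : Fin m → Fin 4} (hx : x ∈ chordLabellings p)
    (i : Fin m) (b : Fin 4) : relabel p x i b ∈ chordLabellings p := by
  rw [mem_chordLabellings] at hx ⊢
  intro j
  have h : (p j = i ∨ p j = p i) ↔ (j = i ∨ j = p i) := by
    constructor
    · rintro (h | h)
      · right; rw [← h, hp]
      · left; rw [← hp j, h, hp]
    · rintro (h | h)
      · right; rw [h]
      · left; rw [h, hp]
  simp only [relabel_apply, h, hx]

theorem chordCoeff_relabel (hp : ∀ i, p (p i) = i) (hne : ∀ i, p i ≠ i) (x : Fin m → Fin 4)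
    (i : Fin m) : ∃ r : K, ∀ b, chordCoeff g p (relabel p x i b) = g b * r := by
  -- `c` is whichever end of the chord through `i` comes first, the only index at which `chordCoeff`
  -- sees this chord.
  obtain ⟨c, hc, hci⟩ : ∃ c, c < p c ∧ ∀ j, j < p j → ((j = i ∨ j = p i) ↔ j = c) := by
    rcases lt_or_gt_of_ne (hne i) with h | h
    · refine ⟨p i, by rwa [hp], fun j hj => ⟨?_, fun h => Or.inr h⟩⟩
      rintro (rfl | rfl)
      · exact (lt_asymm h hj).elim
      · rfl
    · refine ⟨i, h, fun j hj => ⟨?_, fun h => Or.inl h⟩⟩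
      rintro (rfl | rfl)
      · rfl
      · rw [hp] at hj
        exact (lt_asymm h hj).elim
  refine ⟨∏ j ∈ (Finset.univ.filter fun i => i < p i).erase c, g (x j), fun b => ?_⟩
  unfold chordCoeff
  rw [← Finset.mul_prod_erase _ _ (a := c) (by simpa using hc)]
  congr 1
  · rw [relabel_apply, if_pos ((hci c hc).2 rfl)]
  · refine Finset.prod_congr rfl fun j hj => ?_
    simp only [Finset.mem_erase, Finset.mem_filter, Finset.mem_univ, true_and] at hj
    rw [relabel_apply, if_neg fun h => hj.1 ((hci j hj.2).1 h)]

/-- A sum over labellings vanishes if all partial sums over the label of one chord vanish. -/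
theorem sum_labellings_eq_zero [CharZero K] (hp : ∀ i, p (p i) = i) (i : Fin m)
    (φ : (Fin m → Fin 4) → A)
    (h : ∀ x ∈ chordLabellings p, ∑ b, φ (relabel p x i b) = 0) :
    ∑ x ∈ chordLabellings p, φ x = 0 := by
  -- The map (x, b) ↦ (relabelled x, old label) is an involution on pairs, so summing over all
  -- relabellings counts every labelling four times.
  have h1 : ∑ z ∈ chordLabellings p ×ˢ (Finset.univ : Finset (Fin 4)), φ (relabel p z.1 i z.2)
      = ∑ z ∈ chordLabellings p ×ˢ (Finset.univ : Finset (Fin 4)), φ z.1 := by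
    have key : ∀ z : (Fin m → Fin 4) × Fin 4, z.1 ∈ chordLabellings p →
        (relabel p (relabel p z.1 i z.2) i (z.1 i), relabel p z.1 i z.2 i) = z := by
      rintro ⟨x, b⟩ hx
      rw [mem_chordLabellings] at hx
      refine Prod.ext (funext fun j => ?_) (by simp [relabel_apply])
      simp only [relabel_apply]
      split_ifs with h
      · rcases h with rfl | rfl
        · rfl
        · exact (hx i).symm
      · rfl
    refine Finset.sum_bij' (fun z _ => (relabel p z.1 i z.2, z.1 i))
      (fun z _ => (relabel p z.1 i z.2, z.1 i)) ?_ ?_ ?_ ?_ ?_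
    · intro z hz
      simp only [Finset.mem_product, Finset.mem_univ, and_true] at hz ⊢
      exact relabel_mem hp hz i _
    · intro z hz
      simp only [Finset.mem_product, Finset.mem_univ, and_true] at hz ⊢
      exact relabel_mem hp hz i _
    · intro z hz
      exact key z (Finset.mem_product.1 hz).1
    · intro z hz
      exact key z (Finset.mem_product.1 hz).1
    · intro z _; rfl
  rw [Finset.sum_product, Finset.sum_product, Finset.sum_eq_zero h] at h1
  simp only [Finset.sum_const, Finset.card_univ, Fintype.card_fin, ← Finset.smul_sum] at h1
  have h4 : (4 : K) ≠ 0 := by norm_num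
  have h2 : (4 : K) • ∑ x ∈ chordLabellings p, φ x = 0 := by
    rw [h1, ← Nat.cast_smul_eq_nsmul K]; norm_num
  exact (smul_eq_zero_iff_right h4).1 h2

theorem IsSl2Family.commutators (hJ : IsSl2Family J) (c b : Fin 4) :
    J c * J b - J b * J c =
      (![![0, 0, 0, 0], ![0, 0, J 3, J 2], ![0, -J 3, 0, -J 1], ![0, -J 2, J 1, 0]] :
        Fin 4 → Fin 4 → A) c b := by
  have h0 := fun a => sub_eq_zero.2 (hJ.central a)
  have h0' := fun a => sub_eq_zero.2 (hJ.central a).symm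
  have h12 := hJ.comm12
  have h23 := hJ.comm23
  have h31 := hJ.comm31
  have h21 : J 2 * J 1 - J 1 * J 2 = - J 3 := by rw [← h12]; abel
  have h32 : J 3 * J 2 - J 2 * J 3 = J 1 := by rw [← neg_inj, ← h23]; abel
  have h13 : J 1 * J 3 - J 3 * J 1 = J 2 := by rw [← neg_inj, ← h31]; abel
  fin_cases c <;> fin_cases b <;> simp [*]

/-- The invariance of the tensor `∑ g_b J_b ⊗ J_b`, inside an ordered product. -/
theorem sum_pair_bracket (hJ : IsSl2Family J) (η : K) (c : Fin 4) (f : Fin m → A) {i j : Fin m}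
    (hij : i ≠ j) :
    ∑ b, sl2Form η b •
      ((List.ofFn (Function.update (Function.update f i (J c * J b - J b * J c)) j (J b))).prod
      + (List.ofFn (Function.update (Function.update f i (J b)) j (J c * J b - J b * J c))).prod)
      = 0 := by
  have key : ∀ a b : A, (List.ofFn (Function.update (Function.update f i a) j b)).prod
      = MultilinearMap.mkPiAlgebraFin K m A (Function.update (Function.update f i a) j b) :=
    fun _ _ => (MultilinearMap.mkPiAlgebraFin_apply _).symm
  have n1 : ∀ a b : A,
      MultilinearMap.mkPiAlgebraFin K m A (Function.update (Function.update f i (-a)) j b)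
      = - MultilinearMap.mkPiAlgebraFin K m A (Function.update (Function.update f i a) j b) := by
    intro a b
    rw [Function.update_comm hij, MultilinearMap.map_update_neg, Function.update_comm hij]
  have n2 : ∀ a b : A,
      MultilinearMap.mkPiAlgebraFin K m A (Function.update (Function.update f i a) j (-b))
      = - MultilinearMap.mkPiAlgebraFin K m A (Function.update (Function.update f i a) j b) :=
    fun a b => MultilinearMap.map_update_neg _ _ _ _
  have z1 : ∀ b : A,
      MultilinearMap.mkPiAlgebraFin K m A (Function.update (Function.update f i 0) j b) = 0 := by
    intro b
    rw [Function.update_comm hij, MultilinearMap.map_update_zero]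
  have z2 : ∀ a : A,
      MultilinearMap.mkPiAlgebraFin K m A (Function.update (Function.update f i a) j 0) = 0 :=
    fun a => MultilinearMap.map_update_zero _ _ _
  simp only [key, hJ.commutators]
  rw [Fin.sum_univ_four]
  -- For `c ≠ 0` two values of `b` have a nonzero bracket; the weights η, η, -η make their
  -- contributions opposite.
  fin_cases c <;> simp [sl2Form, n1, n2, z1, z2]

/-- The terms of a commutator at the two ends of a chord cancel. -/
theorem sum_chord_bracket_eq_zero [CharZero K] (hJ : IsSl2Family J) (η : K)
    (hp : ∀ i, p (p i) = i) (hne : ∀ i, p i ≠ i) (i : Fin m) (c : (Fin m → Fin 4) → Fin 4)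
    (F : (Fin m → Fin 4) → Fin m → A) (hc : ∀ x b, c (relabel p x i b) = c x)
    (hF : ∀ x b, F (relabel p x i b) = Function.update (Function.update (F x) i (J b)) (p i) (J b)) :
    ∑ x ∈ chordLabellings p, chordCoeff (sl2Form η) p x •
      ((List.ofFn (Function.update (F x) i (J (c x) * J (x i) - J (x i) * J (c x)))).prod
      + (List.ofFn (Function.update (F x) (p i)
          (J (c x) * J (x (p i)) - J (x (p i)) * J (c x)))).prod) = 0 := by
  refine sum_labellings_eq_zero (K := K) hp i _ fun x _ => ?_
  obtain ⟨r, hr⟩ := chordCoeff_relabel (g := sl2Form η) hp hne x i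
  have h := congrArg (r • ·) (sum_pair_bracket hJ η (c x) (F x) (hne i).symm)
  simp only [smul_zero, Finset.smul_sum] at h
  rw [← h]
  refine Finset.sum_congr rfl fun b _ => ?_
  have e1 : relabel p x i b i = b := by simp [relabel_apply]
  have e2 : relabel p x i b (p i) = b := by simp [relabel_apply]
  rw [hr, hc, hF, e1, e2, mul_comm, mul_smul, Function.update_comm (hne i), Function.update_idem,
    Function.update_idem]

theorem update_relabel {B : Type*} (J : Fin 4 → B) (p : Fin m → Fin m) (x : Fin m → Fin 4) (i : Fin m) (b : Fin 4) :
    (fun j => J (relabel p x i b j))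
      = Function.update (Function.update (fun j => J (x j)) i (J b)) (p i) (J b) := by
  funext j
  simp only [relabel, Function.update_apply, apply_ite J]

/-- The inner derivation `a ↦ u a - a u`. -/
def innerDer (u : A) : A →+ A := AddMonoidHom.mulLeft u - AddMonoidHom.mulRight u

theorem innerDer_apply (u a : A) : innerDer u a = u * a - a * u := rfl

theorem innerDer_mul (u a b : A) : innerDer u (a * b) = innerDer u a * b + a * innerDer u b := by
  simp only [innerDer_apply]; noncomm_ring

/-- The plain weight commutes with the `J`'s. -/
theorem plainWeight_commute [CharZero K] (hJ : IsSl2Family J) (η : K)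
    (hp : ∀ i, p (p i) = i) (hne : ∀ i, p i ≠ i) (c : Fin 4) :
    J c * plainWeight (sl2Form η) J p = plainWeight (sl2Form η) J p * J c := by
  rw [← sub_eq_zero, ← innerDer_apply, plainWeight, map_sum]
  have h : ∀ x : Fin m → Fin 4, innerDer (J c) (chordCoeff (sl2Form η) p x •
      (List.ofFn fun i => J (x i)).prod) = ∑ i, chordCoeff (sl2Form η) p x •
        (List.ofFn (Function.update (fun i => J (x i)) i (J c * J (x i) - J (x i) * J c))).prod := by
    intro x
    rw [innerDer_apply, mul_smul_comm, smul_mul_assoc, ← smul_sub, ← innerDer_apply,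
      OrderedProd.leibniz _ (innerDer_mul _), Finset.smul_sum]
    rfl
  simp only [h]
  rw [Finset.sum_comm]
  -- The Leibniz terms at the two ends of each chord cancel.
  refine Finset.sum_involution (fun i _ => p i) (fun i _ => ?_) (fun i _ _ => hne i)
    (fun i _ => Finset.mem_univ _) (fun i _ => hp i)
  rw [← Finset.sum_add_distrib]
  simp only [← smul_add]
  exact sum_chord_bracket_eq_zero hJ η hp hne i (fun _ => c) (fun x j => J (x j))
    (fun _ _ => rfl) fun x b => update_relabel J p x i b

/-- Moving the first factor of all products to the end does not change the plain weight. -/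
theorem plainWeight_rotate_aux [CharZero K] {k : ℕ} {p : Fin (k + 1) → Fin (k + 1)}
    (hJ : IsSl2Family J) (η : K) (hp : ∀ i, p (p i) = i) (hne : ∀ i, p i ≠ i) :
    ∑ x ∈ chordLabellings p, chordCoeff (sl2Form η) p x •
      ((List.ofFn fun i : Fin k => J (x i.succ)).prod * J (x 0)) = plainWeight (sl2Form η) J p := by
  symm
  rw [← sub_eq_zero, plainWeight, ← Finset.sum_sub_distrib]
  set F : (Fin (k + 1) → Fin 4) → Fin (k + 1) → A :=
    fun x => Function.update (fun i => J (x i)) 0 1 with hFdef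
  have h : ∀ x ∈ chordLabellings p, chordCoeff (sl2Form η) p x • (List.ofFn fun i => J (x i)).prod
      - chordCoeff (sl2Form η) p x • ((List.ofFn fun i : Fin k => J (x i.succ)).prod * J (x 0))
      = ∑ i, if i = 0 ∨ i = p 0 then 0 else chordCoeff (sl2Form η) p x •
        (List.ofFn (Function.update (F x) i
          (J (x 0) * J (x i) - J (x i) * J (x 0)))).prod := by
    intro x hx
    rw [mem_chordLabellings] at hx
    have hF : (List.ofFn (F x)).prod = (List.ofFn fun i : Fin k => J (x i.succ)).prod := by
      simp [hFdef, List.ofFn_succ]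
    rw [List.ofFn_succ, List.prod_cons, ← smul_sub, ← innerDer_apply, ← hF,
      OrderedProd.leibniz _ (innerDer_mul _), Finset.smul_sum]
    refine Finset.sum_congr rfl fun i _ => ?_
    split_ifs with hi
    -- Slot 0 now holds 1, and slot `p 0` holds `J (x 0)` itself: both have zero bracket with `J (x
    -- 0)`. This leaves only complete chords, which cancel in pairs.
    · rw [OrderedProd.prod_eq_zero _ i, smul_zero]
      rw [Function.update_self, innerDer_apply]
      rcases hi with rfl | rfl
      · simp [hFdef]
      · simp [hFdef, Function.update_of_ne (hne 0), hx]
    · rw [innerDer_apply, hFdef]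
      simp only [Function.update_of_ne (fun h => hi (Or.inl h) : i ≠ 0)]
  rw [Finset.sum_congr rfl h, Finset.sum_comm]
  refine Finset.sum_involution (fun i _ => p i) (fun i _ => ?_) (fun i _ _ => hne i)
    (fun i _ => Finset.mem_univ _) (fun i _ => hp i)
  rw [← Finset.sum_add_distrib]
  have hiff : (p i = 0 ∨ p i = p 0) ↔ (i = 0 ∨ i = p 0) := by
    constructor
    · rintro (h | h)
      · right; rw [← h, hp]
      · left; rw [← hp i, h, hp]
    · rintro (h | h)
      · right; rw [h]
      · left; rw [h, hp]
  simp only [hiff]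
  by_cases hi : i = 0 ∨ i = p 0
  · simp [hi]
  · simp only [hi, if_false, ← smul_add]
    have h0 : ¬ (0 = i ∨ 0 = p i) := by
      rintro (h | h)
      · exact hi (Or.inl h.symm)
      · exact hi (Or.inr (by rw [h, hp]))
    refine sum_chord_bracket_eq_zero hJ η hp hne i (fun x => x 0) F (fun x b => ?_) fun x b => ?_
    · rw [relabel_apply, if_neg h0]
    · rw [hFdef]
      simp only [update_relabel]
      push Not at h0
      rw [Function.update_comm h0.2.symm, Function.update_comm h0.1.symm]

/-- Each chord has exactly one end in `S`, and `f` does not see which. This is needed because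
rotation turns the first end of a chord into its second end when it passes the cut; written
additively, it also trades second ends for first ends. -/
theorem prod_transversal {B : Type*} [CommMonoid B] (hp : ∀ i, p (p i) = i) (hne : ∀ i, p i ≠ i)
    (S : Finset (Fin m)) (hS : ∀ i, p i ∈ S ↔ i ∉ S) (f : Fin m → B) (hf : ∀ i, f (p i) = f i) :
    ∏ i ∈ S, f i = ∏ i with i < p i, f i := by
  refine Finset.prod_bij' (fun i _ => if i < p i then i else p i)
    (fun i _ => if i ∈ S then i else p i) ?_ ?_ ?_ ?_ ?_
  · intro i _
    split_ifs with h
    · simpa using h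
    · simpa [hp] using lt_of_le_of_ne (not_lt.1 h) (hne i)
  · intro i _
    split_ifs with h
    · exact h
    · exact (hS i).2 h
  · intro i hi
    split_ifs with h1 h2
    · rfl
    · exact ((hS i).1 h2 hi).elim
    · exact hp i
  · intro i hi
    rw [Finset.mem_filter] at hi
    by_cases h1 : i ∈ S
    · simp [h1, hi.2]
    · simp [h1, hp, not_lt_of_gt hi.2]
  · intro i _
    split_ifs <;> simp [hf]

/-- The plain weight is not changed by rotating the cut diagram. -/
theorem plainWeight_rotate [CharZero K] (hJ : IsSl2Family J) (η : K) (hp : ∀ i, p (p i) = i)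
    (hne : ∀ i, p i ≠ i) :
    plainWeight (sl2Form η) J (fun i => (finRotate m).symm (p (finRotate m i)))
      = plainWeight (sl2Form η) J p := by
  cases m with
  | zero => congr 1
  | succ k =>
    rw [← plainWeight_rotate_aux hJ η hp hne]
    set r := finRotate (k + 1) with hr
    refine Finset.sum_bij' (fun x _ => x ∘ r.symm) (fun x _ => x ∘ r) ?_ ?_ ?_ ?_ ?_
    · intro x hx
      rw [mem_chordLabellings] at hx ⊢
      intro i
      simpa using hx (r.symm i)
    · intro x hx
      rw [mem_chordLabellings] at hx ⊢
      intro i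
      simpa using hx (r i)
    · intro x _; funext i; simp
    · intro x _; funext i; simp
    · intro x hx
      rw [mem_chordLabellings] at hx
      congr 1
      -- The first ends for the rotated diagram, carried over by `r`, need not be first ends for
      -- `p`, but still form a transversal of the chords.
      · have hT := prod_transversal hp hne
          ((Finset.univ.filter fun i => i < r.symm (p (r i))).map r.toEmbedding) (fun i => ?_)
          (fun i => sl2Form η (x (r.symm i))) (fun i => ?_)
        · rw [Finset.prod_map] at hT
          simpa [chordCoeff] using hT
        · simp only [Finset.mem_map_equiv, Finset.mem_filter, Finset.mem_univ, true_and,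
            Equiv.apply_symm_apply, hp, not_lt]
          refine ⟨le_of_lt, fun h => lt_of_le_of_ne h fun h' => hne i ?_⟩
          exact r.symm.injective h'
        · have := hx (r.symm i)
          simp only [Equiv.apply_symm_apply] at this
          simp only [this]
      · rw [List.ofFn_succ', List.concat_eq_append, List.prod_append, List.prod_singleton]
        congr 3
        funext i
        have : r.symm i.succ = i.castSucc := by
          rw [Equiv.symm_apply_eq, hr]; simp
        simp [this]

end

/-! ### Independence of the cut. -/

section

variable {K A : Type*} [Field K] [Ring A] [Algebra K A] {J : Fin 4 → A}

theorem sbtw_fin_iff {m : ℕ} (a b c : Fin m) :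
    sbtw a b c ↔ (a < b ∧ b < c) ∨ (b < c ∧ c < a) ∨ (c < a ∧ a < b) := Iff.rfl

theorem sbtw_finRotate {k : ℕ} (a b c : Fin (k + 1)) :
    sbtw (finRotate (k + 1) a) (finRotate (k + 1) b) (finRotate (k + 1) c) ↔ sbtw a b c := by
  simp only [sbtw_fin_iff, Fin.lt_def, coe_finRotate, Fin.ext_iff, Fin.val_last]
  have := a.2
  have := b.2
  have := c.2
  split_ifs <;> omega

/-- Once 0 is fixed, cyclic betweenness starting from 0 is the linear order, so `e` is an order
automorphism of a finite chain. -/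
theorem eq_refl_of_sbtw {k : ℕ} (e : Equiv.Perm (Fin (k + 1))) (h0 : e 0 = 0)
    (h : ∀ a b c, sbtw (e a) (e b) (e c) ↔ sbtw a b c) : e = Equiv.refl _ := by
  have hm : StrictMono e := by
    intro a b hab
    by_cases ha : a = 0
    · subst ha
      rw [h0]
      exact Fin.pos_of_ne_zero fun hb => hab.ne' (e.injective (hb.trans h0.symm))
    · have h1 : sbtw 0 a b := (sbtw_fin_iff _ _ _).2 (Or.inl ⟨Fin.pos_of_ne_zero ha, hab⟩)
      rw [← h, h0, sbtw_fin_iff] at h1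
      rcases h1 with h1 | h1 | h1
      · exact h1.2
      · exact h1.1
      · exact (Fin.not_lt_zero _ h1.1).elim
  have := Subsingleton.elim (hm.orderIsoOfSurjective e e.surjective) (OrderIso.refl _)
  ext a
  exact congrArg Fin.val (DFunLike.congr_fun this a)

/-- A cyclic isomorphism is a power of the rotation: peeling off one rotation lowers `e 0` by one,
until `e 0 = 0` and `e` is the identity. -/
theorem plainWeight_eq_of_iso [CharZero K] (hJ : IsSl2Family J) (η : K) {m : ℕ}
    (p p' : Fin m → Fin m) (hp' : ∀ i, p' (p' i) = i) (hne' : ∀ i, p' i ≠ i)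
    (e : Equiv.Perm (Fin m)) (h : ∀ a b c, sbtw (e a) (e b) (e c) ↔ sbtw a b c)
    (he : ∀ i, e (p i) = p' (e i)) :
    plainWeight (sl2Form η) J p = plainWeight (sl2Form η) J p' := by
  cases m with
  | zero => congr 1; funext i; exact i.elim0
  | succ k =>
    induction hd : (e 0 : ℕ) generalizing p' e with
    | zero =>
      have := eq_refl_of_sbtw e (Fin.ext hd) h
      subst this
      congr 1
      funext i
      simpa using he i
    | succ d ih =>
      set r := finRotate (k + 1) with hr
      rw [← plainWeight_rotate hJ η hp' hne']
      refine ih _ ?_ ?_ (e.trans r.symm) ?_ ?_ ?_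
      · intro i; simp [← hr, hp']
      · intro i hi
        rw [Equiv.symm_apply_eq] at hi
        exact hne' _ hi
      · intro a b c
        rw [← h a b c, ← sbtw_finRotate ((e.trans r.symm) a)]
        simp only [← hr, Equiv.trans_apply, Equiv.apply_symm_apply]
      · intro i
        simp [he, ← hr]
      · have h1 : e 0 = r ((e.trans r.symm) 0) := by simp
        have h2 := congrArg Fin.val h1
        rw [hr, coe_finRotate, ← hr, hd] at h2
        split_ifs at h2
        exact (Nat.succ_injective h2).symm

end

theorem CutDiagram.plainWeight_eq_of_circleIso {K A : Type*} [Field K] [CharZero K] [Ring A]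
    [Algebra K A] {J : Fin 4 → A} (hJ : IsSl2Family J) (η : K) {n : ℕ} {L L' : CutDiagram n}
    (h : CircleIso L L') :
    plainWeight (sl2Form η) J L.partner = plainWeight (sl2Form η) J L'.partner := by
  obtain ⟨e, h, he⟩ := h
  exact plainWeight_eq_of_iso hJ η _ _ L'.partner_partner L'.partner_ne e h he

/-! ### Sorting products that commute up to sign: crossings. -/

section

variable {K T : Type*} [Field K] [Ring T] [Algebra K T] {m : ℕ} {p : Fin m → Fin m}

/-- The crossings of a cut diagram, as pairs of the first ends of the two chords. -/
def crossings (p : Fin m → Fin m) : Finset (Fin m × Fin m) :=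
  Finset.univ.filter fun q => q.1 < q.2 ∧ q.2 < p q.1 ∧ p q.1 < p q.2

/-- Sorting an ordered product of elements commuting up to signs, where equal elements are attached
to the two ends of a chord, for a set of endpoints which is a union of chords. -/
theorem prod_eq_crossings_of_closed (hp : ∀ i, p (p i) = i) (hne : ∀ i, p i ≠ i) (t : Fin 4 → T)
    (σ : Fin 4 → Fin 4 → K) (τ : Fin 4 → K) (hσ : ∀ a b, t a * t b = σ a b • (t b * t a))
    (hσ2 : ∀ a b, σ a b * σ a b = 1) (hτ : ∀ a, t a * t a = algebraMap K T (τ a))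
    (x : Fin m → Fin 4) (hx : ∀ i, x (p i) = x i) (S : Finset (Fin m)) (hS : ∀ i ∈ S, p i ∈ S) :
    (List.ofFn fun i => if i ∈ S then t (x i) else 1).prod = algebraMap K T
      ((∏ i ∈ S with i < p i, τ (x i)) *
        ∏ q ∈ crossings p with q.1 ∈ S ∧ q.2 ∈ S, σ (x (p q.1)) (x q.2)) := by
  induction hc : S.card using Nat.strong_induction_on generalizing S with
  | _ c ih =>
  rcases S.eq_empty_or_nonempty with rfl | hne'
  · rw [OrderedProd.prod_eq_one _ fun i => by simp]
    simp
  -- The chord at the smallest remaining endpoint is removed: its first factor is moved right until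
  -- it meets its partner.
  set i := S.min' hne' with hi
  have hiS : i ∈ S := S.min'_mem hne'
  have hmin : ∀ j ∈ S, i ≤ j := fun j hj => S.min'_le j hj
  have hip : i < p i := lt_of_le_of_ne (hmin _ (hS _ hiS)) (hne i).symm
  set S' := (S.erase i).erase (p i) with hS'def
  have hS' : ∀ j, j ∈ S' ↔ j ≠ p i ∧ j ≠ i ∧ j ∈ S := fun j => by simp [hS'def]
  have hclosed : ∀ j ∈ S', p j ∈ S' := by
    intro j hj
    rw [hS'] at hj ⊢
    refine ⟨fun h => hj.2.1 ?_, fun h => hj.1 ?_, hS j hj.2.2⟩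
    · rw [← hp j, h, hp]
    · rw [← hp j, h]
  have hcard : S'.card < c := by
    rw [← hc]
    exact lt_of_le_of_lt (Finset.card_le_card (Finset.erase_subset _ _))
      (Finset.card_erase_lt_of_mem hiS)
  have hrec := ih _ hcard S' hclosed rfl
  -- `s` is the total sign picked up on the way, one factor for each remaining endpoint before `p
  -- i`.
  set s : K := ∏ j, if j < p i ∧ j ∈ S' then σ (x i) (x j) else 1 with hs
  have hmove : (List.ofFn fun j => if j ∈ S then t (x j) else 1).prod
      = (s * τ (x i)) • (List.ofFn fun j => if j ∈ S' then t (x j) else 1).prod := by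
    rw [OrderedProd.split_at _ i, if_pos hiS, OrderedProd.prod_eq_one, one_mul,
      OrderedProd.split_at _ (p i), if_pos hip, if_pos (hS _ hiS), hx]
    · have e1 : (List.ofFn fun j => if j < p i then
          (if i < j then (if j ∈ S then t (x j) else 1) else 1) else 1)
          = List.ofFn fun j => if j < p i then (if j ∈ S' then t (x j) else 1) else 1 := by
        congr 1; funext j
        by_cases h1 : j < p i
        · by_cases h2 : i < j
          · simp [h1, h2, hS', h1.ne, h2.ne']
          · have : j ∉ S' := fun hj => ((hS' j).1 hj).2.1
              (le_antisymm (not_lt.1 h2) (hmin j ((hS' j).1 hj).2.2))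
            simp [h2, this]
        · simp [h1]
      have e2 : (List.ofFn fun j => if p i < j then
          (if i < j then (if j ∈ S then t (x j) else 1) else 1) else 1)
          = List.ofFn fun j => if p i < j then (if j ∈ S' then t (x j) else 1) else 1 := by
        congr 1; funext j
        by_cases h1 : p i < j
        · simp [h1, hip.trans h1, hS', h1.ne', (hip.trans h1).ne']
        · simp [h1]
      have hpi : p i ∉ S' := fun h => ((hS' _).1 h).1 rfl
      rw [e1, e2, ← mul_assoc, ← mul_assoc, OrderedProd.move (t (x i))
        (fun j => if j < p i ∧ j ∈ S' then σ (x i) (x j) else 1), ← hs,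
        OrderedProd.split_at (fun j => if j ∈ S' then t (x j) else 1) (p i), if_neg hpi, mul_one,
        smul_mul_assoc, smul_mul_assoc, mul_assoc _ (t (x i)) (t (x i)), hτ, mul_smul,
        ← Algebra.commutes, ← Algebra.smul_def, smul_mul_assoc]
      intro j
      by_cases h1 : j < p i
      · by_cases h2 : j ∈ S'
        · simp [h1, h2, hσ (x i)]
        · simp [h2]
      · simp [h1]
    · intro j
      split_ifs with h1 h2
      · exact (not_lt_of_ge (hmin j h2) h1).elim
      · rfl
      · rfl
  have hchords : (∏ j ∈ S with j < p j, τ (x j))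
      = τ (x i) * ∏ j ∈ S' with j < p j, τ (x j) := by
    rw [← Finset.mul_prod_erase (Finset.filter (fun j => j < p j) S) _ (a := i) (by simp [hiS, hip])]
    congr 1
    refine Finset.prod_congr ?_ fun _ _ => rfl
    ext j
    simp only [Finset.mem_erase, Finset.mem_filter, hS']
    refine ⟨fun h => ⟨⟨?_, h.1, h.2.1⟩, h.2.2⟩, fun h => ⟨h.1.2.1, h.1.2.2, h.2⟩⟩
    rintro rfl
    rw [hp] at h
    exact lt_asymm hip h.2.2
  have hcross : (∏ q ∈ crossings p with q.1 ∈ S ∧ q.2 ∈ S, σ (x (p q.1)) (x q.2))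
      = (∏ j ∈ S' with j < p i ∧ p i < p j, σ (x i) (x j))
        * ∏ q ∈ crossings p with q.1 ∈ S' ∧ q.2 ∈ S', σ (x (p q.1)) (x q.2) := by
    have hsplit : (crossings p).filter (fun q => q.1 ∈ S ∧ q.2 ∈ S)
        = ((S'.filter fun j => j < p i ∧ p i < p j).map (.sectR i _)) ∪ (crossings p).filter (fun q => q.1 ∈ S' ∧ q.2 ∈ S') := by
      ext ⟨a, b⟩
      simp only [crossings, Finset.mem_filter, Finset.mem_univ, true_and, Finset.mem_union,
        Finset.mem_map, Function.Embedding.sectR_apply, Prod.mk.injEq, hS']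
      constructor
      · rintro ⟨⟨h1, h2, h3⟩, ha, hb⟩
        have hbi : b ≠ i := (lt_of_le_of_lt (hmin a ha) h1).ne'
        have hbp : b ≠ p i := by
          rintro rfl
          rw [hp] at h3
          exact absurd (hmin _ (hS a ha)) (not_le.2 h3)
        by_cases hai : a = i
        · subst hai
          exact Or.inl ⟨b, ⟨⟨hbp, hbi, hb⟩, h2, h3⟩, rfl, rfl⟩
        · refine Or.inr ⟨⟨h1, h2, h3⟩, ⟨?_, hai, ha⟩, hbp, hbi, hb⟩
          rintro rfl
          rw [hp] at h2
          exact absurd (hmin b hb) (not_le.2 h2)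
      · rintro (⟨j, ⟨⟨hj1, hj2, hj⟩, h2, h3⟩, rfl, rfl⟩ | ⟨h, ha, hb⟩)
        · exact ⟨⟨lt_of_le_of_ne (hmin j hj) hj2.symm, h2, h3⟩, hiS, hj⟩
        · exact ⟨h, ha.2.2, hb.2.2⟩
    rw [hsplit, Finset.prod_union, Finset.prod_map]
    · simp [hx]
    · rw [Finset.disjoint_left]
      rintro ⟨a, b⟩ h1 h2
      simp only [Finset.mem_filter, Finset.mem_map, Function.Embedding.sectR_apply,
        Prod.mk.injEq, hS'] at h1 h2
      obtain ⟨j, -, rfl, -⟩ := h1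
      exact h2.2.1.2.1 rfl
  have hsigns : s = ∏ j ∈ S' with j < p i ∧ p i < p j, σ (x i) (x j) := by
    have h1 : s = ∏ j ∈ S' with j < p i, σ (x i) (x j) := by
      rw [hs, Finset.prod_ite, Finset.prod_const_one, mul_one]
      refine Finset.prod_congr ?_ fun _ _ => rfl
      ext j; simp [and_comm]
    rw [h1, ← Finset.prod_filter_mul_prod_filter_not _ (fun j => p i < p j), Finset.filter_filter]
    -- Chords lying entirely under the removed chord contribute their sign twice, and σ² = 1; only
    -- chords crossing it remain.
    have h2 : ∏ j ∈ (S'.filter fun j => j < p i).filter (fun j => ¬ p i < p j), σ (x i) (x j)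
        = 1 := by
      refine Finset.prod_involution (fun j _ => p j) ?_ (fun j _ _ => hne j) ?_ (fun j _ => hp j)
      · intro j _
        rw [hx, hσ2]
      · intro j hj
        simp only [Finset.mem_filter, not_lt] at hj ⊢
        refine ⟨⟨hclosed j hj.1.1, lt_of_le_of_ne hj.2 fun h => ?_⟩, ?_⟩
        · exact ((hS' j).1 hj.1.1).2.1 (by rw [← hp j, h, hp])
        · rw [hp]; exact hj.1.2.le
    rw [h2, mul_one]
  rw [hmove, hrec, hchords, hcross, hsigns, Algebra.smul_def, ← map_mul]
  congr 1
  ring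

/-- Sorting an ordered product of elements commuting up to signs, where equal elements are attached
to the two ends of a chord. -/
theorem prod_eq_crossings (hp : ∀ i, p (p i) = i) (hne : ∀ i, p i ≠ i) (t : Fin 4 → T)
    (σ : Fin 4 → Fin 4 → K) (τ : Fin 4 → K) (hσ : ∀ a b, t a * t b = σ a b • (t b * t a))
    (hσ2 : ∀ a b, σ a b * σ a b = 1) (hτ : ∀ a, t a * t a = algebraMap K T (τ a))
    (x : Fin m → Fin 4) (hx : ∀ i, x (p i) = x i) :
    (List.ofFn fun i => t (x i)).prod = algebraMap K T
      ((∏ i with i < p i, τ (x i)) * ∏ q ∈ crossings p, σ (x (p q.1)) (x q.2)) := by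
  simpa using prod_eq_crossings_of_closed hp hne t σ τ hσ hσ2 hτ x hx Finset.univ (by simp)

end

/-! ### Removing a chord, and the derivative with respect to the central generator. -/

namespace CutDiagram

variable {K A : Type*} [Field K] [Ring A] [Algebra K A] {g : Fin 4 → K} {J : Fin 4 → A} {n : ℕ}

theorem keptIso_delete_partner (L : CutDiagram n) (i : Fin (2 * n)) (j : Fin (2 * (n - 1))) :
    (L.keptIso i ((L.delete i).partner j) : Fin (2 * n)) = L.partner (L.keptIso i j) := by
  simp [delete]

/-- The removed chord is labelled 0 at both ends and contributes `g 0 = 1`. -/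
theorem chordCoeff_delete (hg : g 0 = 1) (L : CutDiagram n) (i : Fin (2 * n))
    (x : Fin (2 * n) → Fin 4) (hi : x i = 0) (hi' : x (L.partner i) = 0) :
    chordCoeff g (L.delete i).partner (fun j => x (L.keptIso i j))
      = chordCoeff g L.partner x := by
  unfold chordCoeff
  have h : ∏ j with j < (L.delete i).partner j, g (x (L.keptIso i j))
      = ∏ j ∈ (Finset.univ.filter fun j => j < L.partner j).filter (· ∈ L.kept i), g (x j) := by
    refine Finset.prod_bij (fun j _ => (L.keptIso i j : Fin (2 * n))) ?_ ?_ ?_ ?_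
    · intro j hj
      simp only [Finset.mem_filter, Finset.mem_univ, true_and] at hj ⊢
      refine ⟨?_, (L.keptIso i j).2⟩
      rw [← keptIso_delete_partner, Subtype.coe_lt_coe, OrderIso.lt_iff_lt]
      exact hj
    · intro j _ j' _ h
      exact (L.keptIso i).injective (Subtype.ext h)
    · intro j hj
      simp only [Finset.mem_filter, Finset.mem_univ, true_and] at hj
      refine ⟨(L.keptIso i).symm ⟨j, hj.2⟩, ?_, by simp⟩
      simp only [Finset.mem_filter, Finset.mem_univ, true_and]
      rw [← OrderIso.lt_iff_lt (L.keptIso i), ← Subtype.coe_lt_coe, keptIso_delete_partner]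
      simpa using hj.1
    · intro j _; rfl
  rw [h]
  refine Finset.prod_subset (Finset.filter_subset _ _) fun j hj hj' => ?_
  have : ¬ (j ∈ L.kept i) := fun h => hj' (Finset.mem_filter.2 ⟨hj, h⟩)
  rw [mem_kept, not_and_or, not_not, not_not] at this
  rcases this with rfl | rfl <;> simp [hi, hi', hg]

/-- Labellings with label 0 on the chord through `i` restrict bijectively to labellings of the
smaller diagram; the inverse extends by 0. This is how a chord whose two factors `J 0` have been
stripped becomes a removed chord. -/
theorem sum_delete (hg : g 0 = 1) (L : CutDiagram n) (i : Fin (2 * n)) :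
    ∑ x ∈ (chordLabellings L.partner).filter (fun x => x i = 0), chordCoeff g L.partner x •
      (List.ofFn (Function.update (Function.update (fun j => J (x j)) i 1)
        (L.partner i) 1)).prod = plainWeight g J (L.delete i).partner := by
  refine Finset.sum_bij' (fun x _ j => x (L.keptIso i j))
    (fun y _ j => if h : j ∈ L.kept i then y ((L.keptIso i).symm ⟨j, h⟩) else 0) ?_ ?_ ?_ ?_ ?_
  · intro x hx
    rw [Finset.mem_filter, mem_chordLabellings] at hx
    rw [mem_chordLabellings]
    intro j
    rw [keptIso_delete_partner, hx.1]
  · intro y hy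
    rw [mem_chordLabellings] at hy
    rw [Finset.mem_filter, mem_chordLabellings]
    refine ⟨fun j => ?_, by simp [mem_kept]⟩
    by_cases h : j ∈ L.kept i
    · have h' := L.partner_mem_kept i j h
      simp only [h, h', dif_pos]
      rw [← hy]
      congr 1
      refine (L.keptIso i).injective (Subtype.ext ?_)
      rw [keptIso_delete_partner]
      simp [L.partner_partner]
    · have h' : L.partner j ∉ L.kept i := fun h' =>
        h (by simpa [L.partner_partner] using L.partner_mem_kept i _ h')
      simp [h, h']
  · intro x hx
    rw [Finset.mem_filter, mem_chordLabellings] at hx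
    funext j
    split_ifs with h
    · simp
    · rw [mem_kept, not_and_or, not_not, not_not] at h
      rcases h with rfl | rfl
      · exact hx.2.symm
      · rw [hx.1, hx.2]
  · intro y _
    funext j
    simp
  · intro x hx
    rw [Finset.mem_filter, mem_chordLabellings] at hx
    rw [chordCoeff_delete hg L i x hx.2 (by rw [hx.1, hx.2]),
      OrderedProd.prod_eq_prod_orderIso (L.kept i) (L.keptIso i)]
    · congr 3
      funext j
      have := (L.mem_kept i _).1 (L.keptIso i j).2
      rw [Function.update_of_ne this.2, Function.update_of_ne this.1]
    · intro j hj
      rw [mem_kept, not_and_or, not_not, not_not] at hj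
      rcases hj with rfl | rfl
      · simp [Function.update_of_ne (L.partner_ne j).symm]
      · simp

/-- The derivative of the plain weight with respect to `J₀`. -/
theorem derivation_plainWeight (hg : g 0 = 1) (h0 : ∀ a, J 0 * a = a * J 0) (d : A →ₗ[K] A)
    (hd : ∀ a b, d (a * b) = d a * b + a * d b) (hd0 : d (J 0) = 1)
    (hdJ : ∀ a, a ≠ 0 → d (J a) = 0) (L : CutDiagram n) :
    d (plainWeight g J L.partner)
      = 2 * J 0 * ∑ i ∈ L.chords, plainWeight g J (L.delete i).partner := by
  set T : Fin (2 * n) → A := fun i => plainWeight g J (L.delete i).partner with hT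
  -- The removed diagram depends on the chord, not on which of its ends names it.
  have hTi : ∀ i, T (L.partner i) = T i := by
    intro i
    rw [hT]
    simp only
    rw [← sum_delete hg, ← sum_delete hg, L.partner_partner]
    refine Finset.sum_congr ?_ fun x _ => ?_
    · ext x
      rw [Finset.mem_filter, Finset.mem_filter, mem_chordLabellings]
      exact and_congr_right fun h => by rw [h]
    · rw [Function.update_comm (L.partner_ne i)]
  have h1 : d (plainWeight g J L.partner) = ∑ i, J 0 * T i := by
    rw [plainWeight, map_sum]
    have h : ∀ x : Fin (2 * n) → Fin 4, d (chordCoeff g L.partner x •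
        (List.ofFn fun i => J (x i)).prod) = ∑ i, chordCoeff g L.partner x •
          (List.ofFn (Function.update (fun i => J (x i)) i (d (J (x i))))).prod := by
      intro x
      rw [map_smul, ← Finset.smul_sum]
      congr 1
      exact OrderedProd.leibniz d.toAddMonoidHom hd _
    simp only [h]
    rw [Finset.sum_comm]
    refine Finset.sum_congr rfl fun i _ => ?_
    rw [hT]
    simp only
    rw [← sum_delete hg, Finset.mul_sum, Finset.sum_filter]
    refine Finset.sum_congr rfl fun x hx => ?_
    rw [mem_chordLabellings] at hx
    split_ifs with hi
    · rw [mul_smul_comm, hi, hd0]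
      congr 1
      -- Differentiation removed the factor at `i`; the partner still carries the central `J 0`,
      -- which is pulled out in front.
      have hpi : Function.update (fun j => J (x j)) i 1 (L.partner i) = J 0 := by
        rw [Function.update_of_ne (L.partner_ne i), hx, hi]
      rw [OrderedProd.central_factor _ (L.partner i), hpi]
      rw [hpi]; exact h0
    · rw [hdJ _ hi, OrderedProd.prod_eq_zero _ i, smul_zero]
      simp
  -- The second ends form a transversal, so they repeat the sum over first ends; this is the factor
  -- 2.
  have h2 : ∑ i with ¬ i < L.partner i, T i = ∑ i ∈ L.chords, T i := by
    refine prod_transversal (B := Multiplicative A) L.partner_partner L.partner_ne _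
      (fun i => ?_) T hTi
    simp only [Finset.mem_filter, Finset.mem_univ, true_and, not_lt, L.partner_partner, not_le]
    exact ⟨fun h => lt_of_le_of_ne h (L.partner_ne i).symm, le_of_lt⟩
  rw [h1, ← Finset.mul_sum, ← Finset.sum_filter_add_sum_filter_not _ (fun i => i < L.partner i), h2,
    mul_assoc, two_mul (J 0 * _), ← mul_add]
  rfl

end CutDiagram

section

open Polynomial

/-! ### The enveloping algebra of `sl₂` -/

/-- The defining relations of the enveloping algebra of `sl₂` in the basis
`h/2, (e+f)/2, (e-f)/2`. -/
inductive Sl2Rel (K : Type*) [Field K] : FreeAlgebra K (Fin 3) → FreeAlgebra K (Fin 3) → Prop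
  | comm12 : Sl2Rel K (FreeAlgebra.ι K 0 * FreeAlgebra.ι K 1)
      (FreeAlgebra.ι K 1 * FreeAlgebra.ι K 0 + FreeAlgebra.ι K 2)
  | comm23 : Sl2Rel K (FreeAlgebra.ι K 1 * FreeAlgebra.ι K 2)
      (FreeAlgebra.ι K 2 * FreeAlgebra.ι K 1 - FreeAlgebra.ι K 0)
  | comm31 : Sl2Rel K (FreeAlgebra.ι K 2 * FreeAlgebra.ι K 0)
      (FreeAlgebra.ι K 0 * FreeAlgebra.ι K 2 - FreeAlgebra.ι K 1)

/-- The enveloping algebra of `sl₂`. -/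
abbrev Sl2Env (K : Type*) [Field K] : Type _ := RingQuot (Sl2Rel K)

/-- The family `0, h/2, (e+f)/2, (e-f)/2` in the enveloping algebra of `sl₂`. -/
noncomputable def Sl2Env.gen (K : Type*) [Field K] : Fin 4 → Sl2Env K :=
  ![0, RingQuot.mkAlgHom K (Sl2Rel K) (FreeAlgebra.ι K 0),
    RingQuot.mkAlgHom K (Sl2Rel K) (FreeAlgebra.ι K 1),
    RingQuot.mkAlgHom K (Sl2Rel K) (FreeAlgebra.ι K 2)]

theorem Sl2Env.isSl2Family_gen (K : Type*) [Field K] : IsSl2Family (Sl2Env.gen K) where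
  central a := by simp [gen]
  comm12 := by
    have h := RingQuot.mkAlgHom_rel K (Sl2Rel.comm12 (K := K))
    simp only [map_mul, map_add] at h
    simp [gen, h]
  comm23 := by
    have h := RingQuot.mkAlgHom_rel K (Sl2Rel.comm23 (K := K))
    simp only [map_mul, map_sub] at h
    simp [gen, h]
  comm31 := by
    have h := RingQuot.mkAlgHom_rel K (Sl2Rel.comm31 (K := K))
    simp only [map_mul, map_sub] at h
    simp [gen, h]

/-- The universal property. The index 0 is left out since `Sl2Env.gen K 0 = 0`, whereas `J 0` is
arbitrary central. -/
theorem IsSl2Family.exists_lift {K A : Type*} [Field K] [Ring A] [Algebra K A] {J : Fin 4 → A}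
    (hJ : IsSl2Family J) :
    ∃ φ : Sl2Env K →ₐ[K] A, ∀ a, a ≠ 0 → φ (Sl2Env.gen K a) = J a := by
  refine ⟨RingQuot.liftAlgHom K ⟨FreeAlgebra.lift K ![J 1, J 2, J 3], ?_⟩, ?_⟩
  · intro a b h
    have h12 := hJ.comm12
    have h23 := hJ.comm23
    have h31 := hJ.comm31
    cases h
    · simp [← h12]
    · rw [← neg_eq_iff_eq_neg] at h23
      simp [← h23]
    · rw [← neg_eq_iff_eq_neg] at h31
      simp [← h31]
  · intro a ha
    fin_cases a
    · exact (ha rfl).elim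
    all_goals simp [Sl2Env.gen]

theorem Sl2Env.induction_left {K : Type*} [Field K] (M : Submodule K (Sl2Env K)) (h1 : 1 ∈ M)
    (h : ∀ a, a ≠ 0 → ∀ u ∈ M, gen K a * u ∈ M) (u : Sl2Env K) : u ∈ M := by
  -- Absorption of left factors is what passes to products; membership of `u` alone would not.
  suffices H : ∀ u : Sl2Env K, ∀ v ∈ M, u * v ∈ M by simpa using H u 1 h1
  intro u
  obtain ⟨a, rfl⟩ := RingQuot.mkAlgHom_surjective K (Sl2Rel K) u
  induction a using FreeAlgebra.induction with
  | grade0 r =>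
    intro v hv
    rw [AlgHom.commutes, ← Algebra.smul_def]
    exact M.smul_mem r hv
  | grade1 i =>
    intro v hv
    fin_cases i
    · exact h 1 (by decide) v hv
    · exact h 2 (by decide) v hv
    · exact h 3 (by decide) v hv
  | mul a b ha hb =>
    intro v hv
    rw [map_mul, mul_assoc]
    exact ha _ (hb v hv)
  | add a b ha hb =>
    intro v hv
    rw [map_add, add_mul]
    exact M.add_mem (ha v hv) (hb v hv)

/-- The Casimir element of an `sl₂`-family. -/
def sl2Casimir {A : Type*} [Ring A] (J : Fin 4 → A) : A := J 1 * J 1 + J 2 * J 2 - J 3 * J 3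

namespace IsSl2Family

variable {K A : Type*} [Field K] [Ring A] [Algebra K A] {J : Fin 4 → A}

theorem casimir_commute (hJ : IsSl2Family J) (a : Fin 4) :
    J a * sl2Casimir J = sl2Casimir J * J a := by
  rw [← sub_eq_zero, ← innerDer_apply, sl2Casimir, map_sub, map_add, innerDer_mul, innerDer_mul,
    innerDer_mul]
  simp only [innerDer_apply, hJ.commutators]
  fin_cases a <;> simp <;> abel

theorem e_mul (hJ : IsSl2Family J) : (J 2 + J 3) * J 1 = (J 1 - 1) * (J 2 + J 3) := by
  have h1 := hJ.commutators 1 2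
  have h2 := hJ.commutators 1 3
  simp at h1 h2
  rw [sub_eq_iff_eq_add] at h1 h2
  rw [sub_mul, mul_add, h1, h2]
  noncomm_ring

theorem f_mul (hJ : IsSl2Family J) : (J 2 - J 3) * J 1 = (J 1 + 1) * (J 2 - J 3) := by
  have h1 := hJ.commutators 1 2
  have h2 := hJ.commutators 1 3
  simp at h1 h2
  rw [sub_eq_iff_eq_add] at h1 h2
  rw [add_mul, mul_sub, h1, h2]
  noncomm_ring

theorem e_mul_f (hJ : IsSl2Family J) :
    (J 2 + J 3) * (J 2 - J 3) = sl2Casimir J - J 1 * J 1 + J 1 := by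
  have h1 := hJ.commutators 3 2
  simp at h1
  rw [sub_eq_iff_eq_add] at h1
  rw [sl2Casimir, add_mul, mul_sub, mul_sub, h1]
  noncomm_ring

theorem f_mul_e (hJ : IsSl2Family J) :
    (J 2 - J 3) * (J 2 + J 3) = sl2Casimir J - J 1 * J 1 - J 1 := by
  have h1 := hJ.commutators 3 2
  simp at h1
  rw [sub_eq_iff_eq_add] at h1
  rw [sl2Casimir, sub_mul, mul_add, mul_add, h1]
  noncomm_ring

/-- Polynomials in the Casimir element commute with the family. -/
theorem aeval_casimir_commute (hJ : IsSl2Family J) (q : K[X]) (a : Fin 4) :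
    aeval (sl2Casimir J) q * J a = J a * aeval (sl2Casimir J) q := by
  induction q using Polynomial.induction_on' with
  | add p q hp hq => rw [map_add, add_mul, mul_add, hp, hq]
  | monomial n r =>
    rw [aeval_monomial, ← Algebra.smul_def, smul_mul_assoc, mul_smul_comm,
      ((show Commute (J a) (sl2Casimir J) from hJ.casimir_commute a).pow_right n).eq]

/-- The evaluation of polynomials at the Casimir element and `h/2`. -/
noncomputable def evalCH (K : Type*) [Field K] [Algebra K A] (hJ : IsSl2Family J) : K[X][X] →+* A :=
  eval₂RingHom' (aeval (sl2Casimir J) : K[X] →ₐ[K] A).toRingHom (J 1)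
    fun q => hJ.aeval_casimir_commute q 1

theorem evalCH_C (hJ : IsSl2Family J) (q : K[X]) :
    hJ.evalCH K (C q) = aeval (sl2Casimir J) q := by
  simp [evalCH]

theorem evalCH_X (hJ : IsSl2Family J) : hJ.evalCH K X = J 1 := by
  simp [evalCH]

/-- An element which commutes with `h/2` up to a shift commutes so with polynomials in `h/2` and the
Casimir element. -/
theorem exists_shift (hJ : IsSl2Family J) (u : A) (hu : ∀ q : K[X], u * aeval (sl2Casimir J) q =
      aeval (sl2Casimir J) q * u) (s : K[X][X]) (hs : u * J 1 = hJ.evalCH K s * u) (p : K[X][X]) :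
    ∃ p' : K[X][X], u * hJ.evalCH K p = hJ.evalCH K p' * u := by
  induction p using Polynomial.induction_on' with
  | add p q hp hq =>
    obtain ⟨p', hp⟩ := hp
    obtain ⟨q', hq⟩ := hq
    exact ⟨p' + q', by rw [map_add, map_add, mul_add, add_mul, hp, hq]⟩
  | monomial n q =>
    refine ⟨C q * s ^ n, ?_⟩
    have hpow : u * J 1 ^ n = hJ.evalCH K s ^ n * u := by
      induction n with
      | zero => simp
      | succ n ih => rw [pow_succ, ← mul_assoc, ih, mul_assoc, hs, ← mul_assoc, ← pow_succ]
    rw [← C_mul_X_pow_eq_monomial, map_mul, map_mul, map_pow, map_pow, evalCH_C, evalCH_X,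
      ← mul_assoc, hu, mul_assoc, hpow, mul_assoc]

end IsSl2Family

end

/-! ### A PBW spanning set, the centralizer of h, and Verma modules. -/

section

open Polynomial

variable {K A : Type*} [Field K] [Ring A] [Algebra K A] {J : Fin 4 → A}

namespace IsSl2Family

/-- The span of the products `p(C, h) eᵏ` and `p(C, h) fᵏ`. -/
noncomputable def pbwSpan (K : Type*) [Field K] [Algebra K A] (hJ : IsSl2Family J) :
    Submodule K A :=
  Submodule.span K
    {u | ∃ (p : K[X][X]) (k : ℕ), u = hJ.evalCH K p * (J 2 + J 3) ^ k ∨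
      u = hJ.evalCH K p * (J 2 - J 3) ^ k}

/-- Since ef and fe are polynomials in the Casimir element and h, and e, f pass polynomials in h
with a shift, the span is stable under left multiplication by the generators. Only spanning is
needed: Verma modules later take the place of linear independence. -/
theorem mem_pbwSpan [CharZero K] (hJ : IsSl2Family J)
    (hgen : ∀ M : Submodule K A, 1 ∈ M → (∀ a, a ≠ 0 → ∀ u ∈ M, J a * u ∈ M) → ∀ u, u ∈ M)
    (u : A) : u ∈ hJ.pbwSpan K := by
  set β := hJ.evalCH K with hβ
  set e := J 2 + J 3 with he
  set f := J 2 - J 3 with hf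
  have memE : ∀ p k, β p * e ^ k ∈ hJ.pbwSpan K := fun p k =>
    Submodule.subset_span ⟨p, k, Or.inl rfl⟩
  have memF : ∀ p k, β p * f ^ k ∈ hJ.pbwSpan K := fun p k =>
    Submodule.subset_span ⟨p, k, Or.inr rfl⟩
  have hX : β X = J 1 := hJ.evalCH_X
  have hC : β (C X) = sl2Casimir J := by rw [hβ, hJ.evalCH_C, aeval_X]
  have hef : e * f = β (C X - X * X + X) := by
    rw [map_add, map_sub, map_mul, hX, hC]; exact hJ.e_mul_f
  have hfe : f * e = β (C X - X * X - X) := by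
    rw [map_sub, map_sub, map_mul, hX, hC]; exact hJ.f_mul_e
  have he' : ∀ p, ∃ p', e * β p = β p' * e := by
    refine hJ.exists_shift e (fun q => ?_) (X - 1) ?_
    · rw [he, add_mul, mul_add, hJ.aeval_casimir_commute, hJ.aeval_casimir_commute]
    · rw [map_sub, map_one, hJ.evalCH_X]; exact hJ.e_mul
  have hf' : ∀ p, ∃ p', f * β p = β p' * f := by
    refine hJ.exists_shift f (fun q => ?_) (X + 1) ?_
    · rw [hf, sub_mul, mul_sub, hJ.aeval_casimir_commute, hJ.aeval_casimir_commute]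
    · rw [map_add, map_one, hJ.evalCH_X]; exact hJ.f_mul
  have closed : ∀ w : A, (∀ p k, w * (β p * e ^ k) ∈ hJ.pbwSpan K) →
      (∀ p k, w * (β p * f ^ k) ∈ hJ.pbwSpan K) → ∀ v ∈ hJ.pbwSpan K, w * v ∈ hJ.pbwSpan K := by
    intro w h1 h2 v hv
    induction hv using Submodule.span_induction with
    | mem v hv =>
      obtain ⟨p, k, rfl | rfl⟩ := hv
      · exact h1 p k
      · exact h2 p k
    | zero => rw [mul_zero]; exact Submodule.zero_mem _
    | add v v' _ _ h h' => rw [mul_add]; exact Submodule.add_mem _ h h'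
    | smul r v _ h => rw [mul_smul_comm]; exact Submodule.smul_mem _ r h
  have cE : ∀ v ∈ hJ.pbwSpan K, e * v ∈ hJ.pbwSpan K := by
    refine closed e (fun p k => ?_) fun p k => ?_ <;> obtain ⟨p', hp'⟩ := he' p
    · rw [← mul_assoc, hp', mul_assoc, ← pow_succ']
      exact memE _ _
    · cases k with
      | zero => simpa [hp'] using memE p' 1
      | succ k =>
        rw [← mul_assoc, hp', pow_succ', mul_assoc, ← mul_assoc e, hef, ← mul_assoc, ← map_mul]
        exact memF _ _
  have cF : ∀ v ∈ hJ.pbwSpan K, f * v ∈ hJ.pbwSpan K := by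
    refine closed f (fun p k => ?_) fun p k => ?_ <;> obtain ⟨p', hp'⟩ := hf' p
    · cases k with
      | zero => simpa [hp'] using memF p' 1
      | succ k =>
        rw [← mul_assoc, hp', pow_succ', mul_assoc, ← mul_assoc f, hfe, ← mul_assoc, ← map_mul]
        exact memE _ _
    · rw [← mul_assoc, hp', mul_assoc, ← pow_succ']
      exact memF _ _
  have h2 : (2 : K) ≠ 0 := two_ne_zero
  refine hgen (hJ.pbwSpan K) ?_ ?_ u
  · simpa using memE 1 0
  · intro a ha v hv
    fin_cases a
    · exact (ha rfl).elim
    · refine closed (J 1) (fun p k => ?_) (fun p k => ?_) v hv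
      · rw [← mul_assoc, ← hX, ← map_mul]; exact memE _ _
      · rw [← mul_assoc, ← hX, ← map_mul]; exact memF _ _
    · have : J 2 * v = (2 : K)⁻¹ • (e * v + f * v) := by
        rw [eq_inv_smul_iff₀ h2, ← add_mul, he, hf, two_smul]
        simp only [add_mul, sub_mul]
        abel
      exact this ▸ Submodule.smul_mem _ _ (Submodule.add_mem _ (cE v hv) (cF v hv))
    · have : J 3 * v = (2 : K)⁻¹ • (e * v - f * v) := by
        rw [eq_inv_smul_iff₀ h2, ← sub_mul, he, hf, two_smul]
        simp only [add_mul, sub_mul]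
        abel
      exact this ▸ Submodule.smul_mem _ _ (Submodule.sub_mem _ (cE v hv) (cF v hv))

/-- An element which commutes with `h` is a polynomial in the Casimir element and `h`. -/
theorem exists_evalCH_of_commute [CharZero K] (hJ : IsSl2Family J)
    (hgen : ∀ M : Submodule K A, 1 ∈ M → (∀ a, a ≠ 0 → ∀ u ∈ M, J a * u ∈ M) → ∀ u, u ∈ M)
    (u : A) (hu : J 1 * u = u * J 1) : ∃ p : K[X][X], u = hJ.evalCH K p := by
  set β := hJ.evalCH K with hβ
  have hX : β X = J 1 := hJ.evalCH_X
  set D : Module.End K (A) := LinearMap.mulLeft K (J 1) - LinearMap.mulRight K (J 1) with hD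
  have hDa : ∀ v, D v = J 1 * v - v * J 1 := fun v => by simp [hD]
  have hDβ : ∀ p, D (β p) = 0 := fun p => by
    rw [hDa, ← hX, ← map_mul, ← map_mul, mul_comm, sub_self]
  let R : Submodule K (A) :=
    { carrier := Set.range β
      add_mem' := by rintro _ _ ⟨p, rfl⟩ ⟨q, rfl⟩; exact ⟨p + q, map_add _ _ _⟩
      zero_mem' := ⟨0, map_zero _⟩
      smul_mem' := by
        rintro r _ ⟨p, rfl⟩
        refine ⟨C (C r) * p, ?_⟩
        rw [map_mul, hβ, hJ.evalCH_C, aeval_C, ← Algebra.smul_def] }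
  have hpow : ∀ (w : A) (r : K), J 1 * w = w * J 1 + r • w → ∀ k : ℕ,
      J 1 * w ^ k = w ^ k * J 1 + (k * r) • w ^ k := by
    intro w r hw k
    induction k with
    | zero => simp
    | succ k ih =>
      rw [pow_succ, ← mul_assoc, ih, add_mul, mul_assoc, hw, mul_add, smul_mul_assoc,
        mul_smul_comm, ← mul_assoc]
      push_cast
      module
  -- The PBW products are eigenvectors of ad(h/2): `β p * w ^ k` has eigenvalue `k * r`, which is
  -- nonzero for `k > 0` in characteristic 0.
  have heig : ∀ (w : A) (r : K), r ≠ 0 → J 1 * w = w * J 1 + r • w → ∀ p (k : ℕ),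
      β p * w ^ k ∈ R ⊔ ⨆ μ ≠ (0 : K), D.eigenspace μ := by
    intro w r hr hw p k
    rcases Nat.eq_zero_or_pos k with rfl | hk
    · exact Submodule.mem_sup_left ⟨p, by simp⟩
    · refine Submodule.mem_sup_right (Submodule.mem_iSup_of_mem (k * r)
        (Submodule.mem_iSup_of_mem (mul_ne_zero (Nat.cast_ne_zero.2 hk.ne') hr) ?_))
      rw [Module.End.mem_eigenspace_iff, hDa]
      have h := hDβ p
      rw [hDa, sub_eq_zero] at h
      rw [← mul_assoc, h, mul_assoc, hpow w r hw, mul_add, mul_smul_comm, mul_assoc]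
      abel
  have htop : u ∈ R ⊔ ⨆ μ ≠ (0 : K), D.eigenspace μ := by
    refine Submodule.span_le.2 ?_ (hJ.mem_pbwSpan hgen u)
    rintro v ⟨p, k, rfl | rfl⟩
    · refine heig _ 1 one_ne_zero ?_ p k
      have := hJ.e_mul
      rw [one_smul, this, sub_mul, one_mul, sub_add_cancel]
    · refine heig _ (-1) (neg_ne_zero.2 one_ne_zero) ?_ p k
      have := hJ.f_mul
      rw [neg_smul, one_smul, this, add_mul, one_mul, add_neg_cancel_right]
  obtain ⟨_, ⟨p, rfl⟩, v, hv, rfl⟩ := Submodule.mem_sup.1 htop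
  -- `v` commutes with h/2 yet lies in the sum of the nonzero eigenspaces; independence of
  -- eigenspaces forces `v = 0`.
  have hv0 : v ∈ D.eigenspace 0 := by
    rw [Module.End.mem_eigenspace_iff, zero_smul]
    have h1 : D (β p + v) = 0 := by rw [hDa, hu, sub_self]
    rwa [map_add, hDβ, zero_add] at h1
  have := Submodule.disjoint_def.1 (Module.End.eigenspaces_iSupIndep D 0) v hv0 hv
  exact ⟨p, by rw [this, add_zero]⟩

end IsSl2Family

/-- The Verma module of `sl₂` of highest weight `2 l`, on the space of polynomials. -/
noncomputable def vermaFamily {F : Type*} [Field F] (l : F) : Fin 4 → Module.End F F[X] :=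
  let D : Module.End F F[X] := derivative
  let x : Module.End F F[X] := LinearMap.mulLeft F X
  let e : Module.End F F[X] := (2 * l) • D - x * D * D
  ![0, l • 1 - x * D, (2 : F)⁻¹ • (e + x), (2 : F)⁻¹ • (e - x)]

theorem isSl2Family_verma {F : Type*} [Field F] [CharZero F] (l : F) :
    IsSl2Family (vermaFamily l) where
  central a := by simp [vermaFamily]
  comm12 := by
    refine LinearMap.ext fun q => ?_
    simp [vermaFamily, smul_eq_C_mul]
    ring_nf
  comm23 := by
    refine LinearMap.ext fun q => ?_
    have h2 : C (2⁻¹ : F) * 2 = 1 := by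
      rw [← map_ofNat C 2, ← map_mul, inv_mul_cancel₀ two_ne_zero, map_one]
    have hC : C (2 : F) = 2 := map_ofNat C 2
    simp [vermaFamily, smul_eq_C_mul]
    linear_combination (2 * C (2⁻¹ : F) + 1) * (X * derivative q - C l * q) * h2
      + C (2⁻¹ : F) ^ 2 * C l * q * (-2) * hC
  comm31 := by
    refine LinearMap.ext fun q => ?_
    simp [vermaFamily, smul_eq_C_mul]
    ring_nf

end

/-! ### The centre of the enveloping algebra of sl₂. -/

section

open Polynomial

theorem eq_zero_of_aeval_eq_zero {K F : Type*} [Field K] [Field F] [Algebra K F] [Infinite F] (q : K[X]) (h : ∀ c : F, aeval c q = 0) : q = 0 := by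
  refine Polynomial.map_injective (algebraMap K F) (algebraMap K F).injective ?_
  refine Polynomial.funext fun c => ?_
  simpa [eval_map_algebraMap] using h c

variable {K F : Type*} [Field K] [Field F] [CharZero F] [Algebra K F]

theorem verma_apply_X_pow (l : F) (k : ℕ) :
    vermaFamily l 1 (X ^ k) = (l - k) • X ^ k := by
  cases k with
  | zero => simp [vermaFamily]
  | succ k =>
    simp [vermaFamily, sub_smul, smul_eq_C_mul]
    ring

theorem verma_f (l : F) : vermaFamily l 2 - vermaFamily l 3 = LinearMap.mulLeft F X := by
  refine LinearMap.ext fun q => ?_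
  have h2 : C (2⁻¹ : F) * 2 = 1 := by
    rw [← map_ofNat C 2, ← map_mul, inv_mul_cancel₀ two_ne_zero, map_one]
  simp [vermaFamily, smul_eq_C_mul]
  linear_combination X * q * h2

theorem verma_casimir (l : F) : sl2Casimir (vermaFamily l) = algebraMap F _ (l * (l + 1)) := by
  refine LinearMap.ext fun q => ?_
  have h2 : C (2⁻¹ : F) * 2 = 1 := by
    rw [← map_ofNat C 2, ← map_mul, inv_mul_cancel₀ two_ne_zero, map_one]
  have hC : C (2 : F) = 2 := map_ofNat C 2
  simp [sl2Casimir, vermaFamily, smul_eq_C_mul, Module.algebraMap_end_apply]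
  linear_combination (2 * C (2⁻¹ : F) + 1) * (C l * q + 2 * C l * X * derivative q - X * derivative q
      - X ^ 2 * derivative (derivative q)) * h2
    + 2 * C (2⁻¹ : F) ^ 2 * C l * (q + 2 * X * derivative q) * hC

theorem aeval_verma_casimir (l : F) (q : K[X]) :
    aeval (sl2Casimir (vermaFamily l)) q
      = algebraMap F (Module.End F F[X]) (aeval (l * (l + 1)) q) := by
  rw [verma_casimir, aeval_algebraMap_apply]

theorem evalCH_verma_apply (l : F) (p : K[X][X]) (k : ℕ) :
    (isSl2Family_verma l).evalCH K p (X ^ k)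
      = (p.map (aeval (l * (l + 1)) : K[X] →ₐ[K] F).toRingHom).eval (l - k) • X ^ k := by
  induction p using Polynomial.induction_on' with
  | add p q hp hq =>
    rw [map_add, LinearMap.add_apply, hp, hq, Polynomial.map_add, eval_add, add_smul]
  | monomial n q =>
    have hpow : (vermaFamily l 1 ^ n) (X ^ k) = (l - k) ^ n • (X ^ k : F[X]) := by
      induction n with
      | zero => simp
      | succ n ih =>
        rw [pow_succ, Module.End.mul_apply, verma_apply_X_pow, map_smul, ih, smul_smul, pow_succ']
    rw [← C_mul_X_pow_eq_monomial, map_mul, map_pow (IsSl2Family.evalCH K _),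
      IsSl2Family.evalCH_C, IsSl2Family.evalCH_X, Module.End.mul_apply, hpow, aeval_verma_casimir, Module.algebraMap_end_apply, smul_smul]
    simp

/-- Over an algebraically closed field every scalar is thus the Casimir eigenvalue of some Verma
module; the root comes from completing the square. -/
theorem exists_mul_succ_eq [IsAlgClosed F] (c : F) : ∃ l : F, l * (l + 1) = c := by
  obtain ⟨z, hz⟩ := IsAlgClosed.exists_eq_mul_self (1 + 4 * c)
  refine ⟨(z - 1) / 2, ?_⟩
  field_simp
  linear_combination -hz

theorem Sl2Env.exists_verma (K : Type*) [Field K] [Algebra K F] (l : F) :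
    ∃ ρ : Sl2Env K →ₐ[K] Module.End F F[X], ∀ a, ρ (gen K a) = vermaFamily l a := by
  obtain ⟨ρ, hρ⟩ := (isSl2Family_verma l).exists_lift (K := K)
  refine ⟨ρ, fun a => ?_⟩
  rcases eq_or_ne a 0 with rfl | ha
  · simp [gen, vermaFamily]
  · exact hρ a ha

theorem map_sl2Casimir {A B : Type*} [Ring A] [Ring B] [Algebra K A] [Algebra K B] (φ : A →ₐ[K] B)
    {J : Fin 4 → A} {J' : Fin 4 → B} (h : ∀ a, a ≠ 0 → φ (J a) = J' a) :
    φ (sl2Casimir J) = sl2Casimir J' := by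
  simp [sl2Casimir, h]

theorem map_evalCH {A B : Type*} [Ring A] [Ring B] [Algebra K A] [Algebra K B] (φ : A →ₐ[K] B)
    {J : Fin 4 → A} {J' : Fin 4 → B} (hJ : IsSl2Family J) (hJ' : IsSl2Family J')
    (h : ∀ a, a ≠ 0 → φ (J a) = J' a) (p : K[X][X]) :
    φ (hJ.evalCH K p) = hJ'.evalCH K p := by
  induction p using Polynomial.induction_on' with
  | add p q hp hq => rw [map_add, map_add, hp, hq, map_add]
  | monomial n q =>
    rw [← C_mul_X_pow_eq_monomial, map_mul, map_mul, map_mul, map_pow, map_pow, map_pow,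
      IsSl2Family.evalCH_C, IsSl2Family.evalCH_C, IsSl2Family.evalCH_X, IsSl2Family.evalCH_X,
      h 1 (by decide), ← aeval_algHom_apply, map_sl2Casimir φ h]

/-- The Casimir element of `sl₂` is transcendental. -/
theorem Sl2Env.aeval_casimir_injective [CharZero K] :
    Function.Injective (aeval (sl2Casimir (gen K)) : K[X] →ₐ[K] Sl2Env K) := by
  rw [injective_iff_map_eq_zero]
  intro q hq
  have : CharZero (AlgebraicClosure K) := charZero_of_injective_algebraMap (algebraMap K _).injective
  refine eq_zero_of_aeval_eq_zero (F := AlgebraicClosure K) q fun c => ?_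
  obtain ⟨l, rfl⟩ := exists_mul_succ_eq c
  obtain ⟨ρ, hρ⟩ := exists_verma K l
  have h := congrArg ρ hq
  rw [← aeval_algHom_apply, map_sl2Casimir ρ fun a _ => hρ a, aeval_verma_casimir, map_zero] at h
  have h1 := congrArg (fun φ => φ (X ^ 0)) h
  simpa [Module.algebraMap_end_apply] using h1

/-- An element of the enveloping algebra of `sl₂` commuting with all generators is a polynomial in
the Casimir element. -/
theorem Sl2Env.exists_aeval_casimir [CharZero K] (u : Sl2Env K)
    (hu : ∀ a, gen K a * u = u * gen K a) : ∃ q : K[X], u = aeval (sl2Casimir (gen K)) q := by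
  have : CharZero (AlgebraicClosure K) := charZero_of_injective_algebraMap (algebraMap K _).injective
  obtain ⟨p, rfl⟩ := (isSl2Family_gen K).exists_evalCH_of_commute (K := K)
    (fun M => induction_left M) u (hu 1)
  suffices hp : p = C (p.eval 0) from
    ⟨p.eval 0, by conv_lhs => rw [hp]
                  rw [IsSl2Family.evalCH_C]⟩
  ext1 n
  rw [← sub_eq_zero, ← coeff_sub]
  refine eq_zero_of_aeval_eq_zero (F := AlgebraicClosure K) _ fun c => ?_
  obtain ⟨l, rfl⟩ := exists_mul_succ_eq c
  obtain ⟨ρ, hρ⟩ := exists_verma K l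
  set θ := (aeval (l * (l + 1)) : K[X] →ₐ[K] AlgebraicClosure K).toRingHom with hθ
  -- Commutation with f, which acts as multiplication by `X`, equates the eigenvalues on consecutive
  -- weight vectors. Hence p(C, ·) is constant on the infinite set l - ℕ, so constant in h.
  have hstep : ∀ k : ℕ, (p.map θ).eval (l - (k + 1 : ℕ)) = (p.map θ).eval (l - k) := by
    intro k
    have h : (gen K 2 - gen K 3) * (isSl2Family_gen K).evalCH K p
        = (isSl2Family_gen K).evalCH K p * (gen K 2 - gen K 3) := by
      rw [sub_mul, mul_sub, hu, hu]
    have h1 := congrArg (fun w => ρ w (X ^ k)) h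
    simp only [map_mul, map_sub, hρ, verma_f,
      map_evalCH ρ (isSl2Family_gen K) (isSl2Family_verma l) fun a _ => hρ a,
      Module.End.mul_apply, evalCH_verma_apply, LinearMap.mulLeft_apply, mul_smul_comm,
      ← pow_succ'] at h1
    exact (smul_left_injective _ (pow_ne_zero _ X_ne_zero) h1).symm
  have hconst : ∀ k : ℕ, (p.map θ).eval (l - k) = (p.map θ).eval l := by
    intro k
    induction k with
    | zero => simp
    | succ k ih => rw [hstep, ih]
  have hP : p.map θ = C ((p.map θ).eval l) := by
    refine Polynomial.eq_of_infinite_eval_eq _ _ (Set.Infinite.mono ?_ (Set.infinite_range_of_injective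
      (f := fun k : ℕ => l - (k : AlgebraicClosure K)) fun a b h => by simpa using h))
    rintro _ ⟨k, rfl⟩
    simp [hconst]
  have h0 : p.map θ = C (θ (p.eval 0)) := by
    have h1 : (p.map θ).eval 0 = θ (p.eval 0) := by
      rw [← map_zero θ, eval_map_apply]
    rw [← h1, hP, eval_C]
  have h1 := congrArg (fun P => P.coeff n) h0
  change θ _ = 0
  rw [← coeff_map, Polynomial.map_sub, h0, Polynomial.map_C, sub_self, coeff_zero]

end

/-! ### The universal model: polynomials over the enveloping algebra of sl₂. -/

section

open Polynomial

/-- The family `X, h/2, (e+f)/2, (e-f)/2` in the polynomials over the enveloping algebra of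
`sl₂`. -/
noncomputable def Sl2Env.polyGen (K : Type*) [Field K] : Fin 4 → (Sl2Env K)[X] :=
  ![X, C (gen K 1), C (gen K 2), C (gen K 3)]

variable {K : Type*} [Field K]

theorem Sl2Env.isSl2Family_polyGen : IsSl2Family (polyGen K) where
  central a := by simp [polyGen, X_mul]
  comm12 := by
    change C _ * C _ - C _ * C _ = C _
    rw [← C_mul, ← C_mul, ← C_sub, (isSl2Family_gen K).comm12]
  comm23 := by
    change C _ * C _ - C _ * C _ = - C _
    rw [← C_mul, ← C_mul, ← C_sub, ← C_neg, (isSl2Family_gen K).comm23]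
  comm31 := by
    change C _ * C _ - C _ * C _ = - C _
    rw [← C_mul, ← C_mul, ← C_sub, ← C_neg, (isSl2Family_gen K).comm31]

/-- The substitution `c = X² + y`. -/
noncomputable def splitHom (K : Type*) [Field K] : MvPolynomial (Fin 2) K →ₐ[K] K[X][X] :=
  MvPolynomial.aeval ![X ^ 2 + C X, C X]

/-- The substitution `c = X² + y`, `y = η C` for the Casimir element `C` of `sl₂`. -/
noncomputable def Sl2Env.evalXC (η : K) : MvPolynomial (Fin 2) K →ₐ[K] (Sl2Env K)[X] :=
  (mapAlgHom (aeval (η • sl2Casimir (gen K)))).comp (splitHom K)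

/-- The chain rule for c = X² + y; both sides obey the Leibniz rule, so the generators decide. -/
theorem derivative_splitHom (P : MvPolynomial (Fin 2) K) :
    derivative (splitHom K P) = 2 * X * splitHom K (MvPolynomial.pderiv 0 P) := by
  induction P using MvPolynomial.induction_on with
  | C a =>
    have : splitHom K (MvPolynomial.C a) = C (C a) := by
      rw [splitHom, MvPolynomial.aeval_C]; rfl
    simp [this]
  | add p q hp hq => simp only [map_add, hp, hq, mul_add]
  | mul_X p i hp =>
    rw [map_mul, derivative_mul, hp, Derivation.leibniz, map_add, smul_eq_mul, smul_eq_mul, map_mul,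
      map_mul]
    fin_cases i
    · simp [splitHom, MvPolynomial.pderiv_X]
      ring
    · simp [splitHom, MvPolynomial.pderiv_X]
      ring

theorem Sl2Env.derivative_evalXC (η : K) (P : MvPolynomial (Fin 2) K) :
    derivative (evalXC η P) = 2 * X * evalXC η (MvPolynomial.pderiv 0 P) := by
  simp only [evalXC, AlgHom.comp_apply, coe_mapAlgHom, derivative_map, derivative_splitHom,
    Polynomial.map_mul, Polynomial.map_ofNat, Polynomial.map_X]

/-- Over the algebraic closure every point (c, y) has the form (z² + y, y), with z a square root of
c - y, so a polynomial in the kernel vanishes at all points. -/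
theorem splitHom_injective [CharZero K] : Function.Injective (splitHom K) := by
  rw [injective_iff_map_eq_zero]
  intro P hP
  refine MvPolynomial.map_injective (algebraMap K (AlgebraicClosure K))
    (algebraMap K (AlgebraicClosure K)).injective ?_
  have : CharZero (AlgebraicClosure K) := charZero_of_injective_algebraMap (algebraMap K _).injective
  refine MvPolynomial.funext fun v => ?_
  obtain ⟨z, hz⟩ := IsAlgClosed.exists_eq_mul_self (v 0 - v 1)
  let φ : K[X][X] →ₐ[K] AlgebraicClosure K :=
    { eval₂RingHom (aeval (v 1) : K[X] →ₐ[K] AlgebraicClosure K).toRingHom z with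
      commutes' := fun r => by simp [Polynomial.algebraMap_apply] }
  have h : φ.comp (splitHom K) = MvPolynomial.aeval v := by
    refine MvPolynomial.algHom_ext fun i => ?_
    fin_cases i
    · simp [splitHom, φ]
      linear_combination -hz
    · simp [splitHom, φ]
  have h1 := congrArg φ hP
  rw [← AlgHom.comp_apply, h, map_zero] at h1
  rw [MvPolynomial.eval_map, map_zero, map_zero]
  exact h1

/-- The Casimir element is transcendental, and so is its multiple by the invertible scalar `η`; then
`splitHom_injective` applies. -/
theorem Sl2Env.evalXC_injective [CharZero K] {η : K} (hη : η ≠ 0) :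
    Function.Injective (evalXC η) := by
  have h1 : Function.Injective (aeval (η • sl2Casimir (gen K)) : K[X] →ₐ[K] Sl2Env K) := by
    rw [injective_iff_map_eq_zero]
    intro q hq
    have h2 : aeval (η • sl2Casimir (gen K)) q
        = aeval (sl2Casimir (gen K)) (q.comp (C η * X)) := by
      rw [aeval_comp]; simp [Algebra.smul_def]
    rw [h2, map_eq_zero_iff _ aeval_casimir_injective] at hq
    have h3 : (q.comp (C η * X)).comp (C η⁻¹ * X) = q := by
      rw [comp_assoc]
      simp [← mul_assoc, ← C_mul, hη]
    rw [← h3, hq, zero_comp]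
  rw [evalXC]
  exact (Polynomial.map_injective (aeval (η • sl2Casimir (gen K)) : K[X] →ₐ[K] Sl2Env K).toRingHom
    h1).comp splitHom_injective

theorem MvPolynomial.exists_pderiv_eq [CharZero K] {ι : Type*} (i : ι) (Q : MvPolynomial ι K) :
    ∃ P, MvPolynomial.pderiv i P = Q := by
  classical
  induction Q using MvPolynomial.induction_on' with
  | monomial s a =>
    refine ⟨MvPolynomial.monomial (s + Finsupp.single i 1) (a / (s i + 1)), ?_⟩
    rw [MvPolynomial.pderiv_monomial]
    have : (s i : K) + 1 ≠ 0 := by exact_mod_cast Nat.succ_ne_zero (s i)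
    simp [this]
  | add p q hp hq =>
    obtain ⟨p', rfl⟩ := hp
    obtain ⟨q', rfl⟩ := hq
    exact ⟨p' + q', map_add _ _ _⟩

section torsion

variable {R : Type*} [Ring R] [Algebra K R] [CharZero K]

theorem Polynomial.eq_C_of_derivative_eq_zero' (K : Type*) [Field K] [CharZero K] [Algebra K R]
    (p : R[X]) (h : derivative p = 0) : p = C (p.coeff 0) := by
  ext n
  cases n with
  | zero => simp
  | succ n =>
    have h1 := congrArg (fun q => q.coeff n) h
    simp only [coeff_derivative, coeff_zero] at h1
    have h2 : ((n + 1 : ℕ) : K) • p.coeff (n + 1) = 0 := by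
      rw [Algebra.smul_def, Algebra.commutes, map_natCast]
      exact_mod_cast h1
    rw [coeff_C_succ]
    exact (smul_eq_zero_iff_right (Nat.cast_ne_zero.2 n.succ_ne_zero)).1 h2

/-- The scalar 2 is invertible and `X` only shifts coefficients, so no domain hypothesis on `R` is
required. -/
theorem Polynomial.two_mul_X_cancel (K : Type*) [Field K] [CharZero K] [Algebra K R] {p q : R[X]}
    (h : 2 * X * p = 2 * X * q) : p = q := by
  have h2 : ∀ p : R[X], 2 * X * p = (2 : K) • (X * p) := fun p => by
    rw [Algebra.smul_def, map_ofNat, mul_assoc]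
  rw [h2, h2] at h
  have h3 := smul_right_injective _ (two_ne_zero (α := K)) h
  ext n
  simpa using congrArg (fun q => q.coeff (n + 1)) h3

end torsion

/-- The constant coefficient as a homomorphism of algebras. -/
def Polynomial.constantCoeffAlgHom (K R : Type*) [Field K] [Ring R] [Algebra K R] :
    R[X] →ₐ[K] R :=
  { constantCoeff with commutes' := fun r => by simp [Polynomial.algebraMap_apply] }

namespace CutDiagram

variable {n : ℕ}

theorem derivative_plainWeight_polyGen (η : K) (L : CutDiagram n) :
    derivative (plainWeight (sl2Form η) (Sl2Env.polyGen K) L.partner)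
      = 2 * X * ∑ i ∈ L.chords,
        plainWeight (sl2Form η) (Sl2Env.polyGen K) (L.delete i).partner := by
  have h := derivation_plainWeight (g := sl2Form η) (J := Sl2Env.polyGen K) rfl
    Sl2Env.isSl2Family_polyGen.central (derivative.restrictScalars K)
    (fun a b => derivative_mul) (by simp [Sl2Env.polyGen]) (fun a ha => by
      fin_cases a
      · exact (ha rfl).elim
      all_goals simp [Sl2Env.polyGen]) L
  exact h

/-- If `P(c, y)` is the weight, then `∂P/∂c` is the sum of the weights with one chord removed. -/
theorem evalXC_pderiv [CharZero K] (η : K) (L : CutDiagram n) (P : MvPolynomial (Fin 2) K)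
    (hP : Sl2Env.evalXC η P = plainWeight (sl2Form η) (Sl2Env.polyGen K) L.partner) :
    Sl2Env.evalXC η (MvPolynomial.pderiv 0 P)
      = ∑ i ∈ L.chords, plainWeight (sl2Form η) (Sl2Env.polyGen K) (L.delete i).partner := by
  refine Polynomial.two_mul_X_cancel K ?_
  rw [← Sl2Env.derivative_evalXC, hP, derivative_plainWeight_polyGen]

/-- The weight is a polynomial in `X² + y` and `y`. -/
theorem exists_evalXC_eq [CharZero K] {η : K} (hη : η ≠ 0) (L : CutDiagram n) : ∃ P,
    Sl2Env.evalXC η P = plainWeight (sl2Form η) (Sl2Env.polyGen K) L.partner := by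
  induction n using Nat.strong_induction_on with
  | _ n ih =>
  have hdel : ∀ i : Fin (2 * n), ∃ P, Sl2Env.evalXC η P
      = plainWeight (sl2Form η) (Sl2Env.polyGen K) (L.delete i).partner := fun i =>
    ih (n - 1) (by have := i.2; omega) (L.delete i)
  choose P hP using hdel
  -- `Q` has the derivative that the weight must have, so the difference is free of `X`.
  obtain ⟨Q, hQ⟩ := MvPolynomial.exists_pderiv_eq (0 : Fin 2) (∑ i ∈ L.chords, P i)
  set W := plainWeight (sl2Form η) (Sl2Env.polyGen K) L.partner with hW
  have hd : derivative (W - Sl2Env.evalXC η Q) = 0 := by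
    rw [derivative_sub, derivative_plainWeight_polyGen, Sl2Env.derivative_evalXC, hQ, map_sum]
    simp only [hP, sub_self]
  have hconst := Polynomial.eq_C_of_derivative_eq_zero' K _ hd
  obtain ⟨q, hq⟩ : ∃ q : K[X], (W - Sl2Env.evalXC η Q).coeff 0
      = aeval (sl2Casimir (Sl2Env.gen K)) q := by
    refine Sl2Env.exists_aeval_casimir _ fun a => ?_
    -- Setting X = 0 turns `polyGen` into `gen`, so the constant coefficient is itself a plain
    -- weight and therefore central.
    have e1 : W.coeff 0 = plainWeight (sl2Form η) (Sl2Env.gen K) L.partner := by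
      have h := map_plainWeight (g := sl2Form η) (J := Sl2Env.polyGen K) (p := L.partner)
        (Polynomial.constantCoeffAlgHom K (Sl2Env K))
      have hJ : (fun a => Polynomial.constantCoeffAlgHom K (Sl2Env K) (Sl2Env.polyGen K a))
          = Sl2Env.gen K := by
        funext a
        fin_cases a <;> simp [Polynomial.constantCoeffAlgHom, Sl2Env.polyGen, Sl2Env.gen]
      rw [hJ] at h
      exact h
    have e2 : ∃ r : K[X], (Sl2Env.evalXC η Q).coeff 0 = aeval (η • sl2Casimir (Sl2Env.gen K)) r :=
      ⟨(splitHom K Q).coeff 0, by simp [Sl2Env.evalXC]⟩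
    obtain ⟨r, hr⟩ := e2
    have e3 : aeval (η • sl2Casimir (Sl2Env.gen K)) r
        = aeval (sl2Casimir (Sl2Env.gen K)) (r.comp (C η * X)) := by
      rw [aeval_comp]; simp [Algebra.smul_def]
    rw [coeff_sub, e1, hr, e3, mul_sub, sub_mul, (Sl2Env.isSl2Family_gen K).aeval_casimir_commute,
      plainWeight_commute (Sl2Env.isSl2Family_gen K) η L.partner_partner L.partner_ne]
  -- The variable y maps to `η` times the Casimir element, hence the rescaling by `η⁻¹`.
  refine ⟨Q + Polynomial.aeval (MvPolynomial.C η⁻¹ * MvPolynomial.X 1) q, ?_⟩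
  have e4 : Sl2Env.evalXC η (MvPolynomial.C η⁻¹ * MvPolynomial.X 1)
      = CAlgHom (R := K) (sl2Casimir (Sl2Env.gen K)) := by
    have e5 : splitHom K (MvPolynomial.C η⁻¹ * MvPolynomial.X 1) = C (C η⁻¹ * X) := by
      rw [map_mul, C_mul, splitHom, MvPolynomial.aeval_C]
      simp [Polynomial.algebraMap_apply]
    rw [Sl2Env.evalXC, AlgHom.comp_apply, e5]
    simp only [coe_mapAlgHom, Polynomial.map_C]
    refine congrArg C ?_
    change aeval _ (C η⁻¹ * X) = _
    rw [map_mul, aeval_C, aeval_X, ← Algebra.smul_def, inv_smul_smul₀ hη]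
  rw [map_add, ← aeval_algHom_apply, e4, aeval_algHom_apply, ← hq]
  exact (sub_eq_iff_eq_add'.1 hconst).symm

end CutDiagram

end

/-! ### Passing between U(A1_ε) and sl₂ by twisting with matrices. -/

section

open TensorProduct

variable {K : Type*} [Field K]

theorem prod_tmul {A B : Type*} [Ring A] [Ring B] [Algebra K A] [Algebra K B] {m : ℕ}
    (a : Fin m → A) (b : Fin m → B) :
    (List.ofFn fun i => a i ⊗ₜ[K] b i).prod = (List.ofFn a).prod ⊗ₜ[K] (List.ofFn b).prod := by
  induction m with
  | zero => simp [Algebra.TensorProduct.one_def]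
  | succ m ih => simp [List.ofFn_succ, ih]

/-- Matrices which commute up to the signs of the commuting factor. -/
def twist (K : Type*) [Field K] (ε : ℤˣ) : Fin 4 → Matrix (Fin 2) (Fin 2) K :=
  ![1, !![1, 0; 0, -1], !![0, 1; ((ε : ℤ) : K), 0], !![0, 1; -((ε : ℤ) : K), 0]]

/-- The squares of the matrices `twist`. -/
def twistSq (K : Type*) [Field K] (ε : ℤˣ) : Fin 4 → K := ![1, 1, ((ε : ℤ) : K), -((ε : ℤ) : K)]

theorem twist_mul_self (ε : ℤˣ) (a : Fin 4) :
    twist K ε a * twist K ε a = algebraMap K _ (twistSq K ε a) := by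
  rw [Matrix.algebraMap_eq_diagonal]
  fin_cases a
  · simp [twist, twistSq]
  all_goals
    ext i j
    fin_cases i <;> fin_cases j <;> simp [twist, twistSq]

theorem twist_mul_twist (ε : ℤˣ) (a b : Fin 4) :
    twist K ε a * twist K ε b = A1.commFactor K a b • (twist K ε b * twist K ε a) := by
  have h1 : (1 : ZMod 2).val = 1 := rfl
  fin_cases a <;> fin_cases b <;> simp [twist, A1.commFactor, A1.deg, h1]

theorem commFactor_mul_self (a b : Fin 4) :
    A1.commFactor K a b * A1.commFactor K a b = 1 := by
  rw [A1.commFactor, ← mul_pow]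
  simp

theorem twist_products (ε : ℤˣ) :
    (twist K ε 1 * twist K ε 2 = twist K ε 3 ∧ twist K ε 2 * twist K ε 1 = - twist K ε 3) ∧
    (twist K ε 2 * twist K ε 3 = -((ε : ℤ) : K) • twist K ε 1 ∧
      twist K ε 3 * twist K ε 2 = ((ε : ℤ) : K) • twist K ε 1) ∧
    (twist K ε 3 * twist K ε 1 = - twist K ε 2 ∧ twist K ε 1 * twist K ε 3 = twist K ε 2) := by
  simp [twist]

theorem sub_eq_of_add_eq_zero {R : Type*} [Ring R] {a b b' c : R} (h : b + b' = 0)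
    (h' : a + b' = c) : a - b = c := by
  rw [← h', eq_neg_of_add_eq_zero_left h, sub_neg_eq_add]

theorem sub_eq_neg_of_add_eq_zero {R : Type*} [Ring R] {a a' b c : R} (h : a + a' = 0)
    (h' : a' + b = c) : a - b = -c := by
  rw [← h', eq_neg_of_add_eq_zero_left h, neg_add, sub_eq_add_neg]

theorem tmul_neg_add_tmul {A B : Type*} [Ring A] [Ring B] [Algebra K A] [Algebra K B] (a : A)
    (b : B) : a ⊗ₜ[K] (-b) + a ⊗ₜ[K] b = 0 := by
  rw [← TensorProduct.tmul_add, neg_add_cancel, TensorProduct.tmul_zero]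

/-- The `sl₂`-family in `U(A1_ε) ⊗ M₂(K)`. -/
noncomputable def twistedQ (K : Type*) [Field K] (ε : ℤˣ) (a : Fin 4) :
    A1.Env K ε ⊗[K] Matrix (Fin 2) (Fin 2) K :=
  A1.Q K ε a ⊗ₜ twist K ε a

/-- For distinct nonzero indices the matrices anticommute, so the commutator is {Q_a, Q_b} ⊗ t_a
t_b, and t_a t_b is a scalar multiple of the third matrix (`twist_products`). -/
theorem isSl2Family_twistedQ (ε : ℤˣ) : IsSl2Family (twistedQ K ε) where
  central a := by
    have hc := A1.mem_center_of_commute K ε _ (A1.Q_zero_commute K ε)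
    rw [Subalgebra.mem_center_iff] at hc
    have h0 : twist K ε 0 = 1 := rfl
    induction a with
    | zero => simp
    | tmul u m => simp [twistedQ, h0, hc]
    | add x y hx hy => rw [mul_add, add_mul, hx, hy]
  comm12 := by
    obtain ⟨h1, h2⟩ := (twist_products (K := K) ε).1
    simp only [twistedQ, Algebra.TensorProduct.tmul_mul_tmul, h1, h2]
    refine sub_eq_of_add_eq_zero (tmul_neg_add_tmul _ _) ?_
    rw [← TensorProduct.add_tmul, (A1.anticomm K ε).1, sub_add_cancel]
  comm23 := by
    obtain ⟨h1, h2⟩ := (twist_products (K := K) ε).2.1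
    simp only [twistedQ, Algebra.TensorProduct.tmul_mul_tmul, h1, h2, neg_smul]
    refine sub_eq_neg_of_add_eq_zero (tmul_neg_add_tmul _ _) ?_
    rw [← TensorProduct.add_tmul, (A1.anticomm K ε).2.2.1, sub_add_cancel,
      TensorProduct.smul_tmul, smul_smul, A1.sign_sq, one_smul]
  comm31 := by
    obtain ⟨h1, h2⟩ := (twist_products (K := K) ε).2.2
    simp only [twistedQ, Algebra.TensorProduct.tmul_mul_tmul, h1, h2]
    refine sub_eq_neg_of_add_eq_zero (tmul_neg_add_tmul _ _) ?_
    rw [← TensorProduct.add_tmul, (A1.anticomm K ε).2.2.2.2.1, sub_add_cancel]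

/-- Each chord coefficient splits into the form used for sl₂ and the square of the matrix at its
ends; the latter is what sorting the matrices produces. -/
theorem formInv_apply (ε : ℤˣ) (a b : Fin 4) :
    A1.formInv K ε a b = if a = b then sl2Form ((ε : ℤ) : K) a * twistSq K ε a else 0 := by
  rw [A1.formInv_eq, A1.form, Matrix.diagonal_apply]
  refine if_congr Iff.rfl ?_ rfl
  fin_cases a <;> simp [sl2Form, twistSq, A1.sign_sq]

/-- The weight is the plain weight of the twisted generators. -/
theorem CutDiagram.weight_tmul_one {n : ℕ} (ε : ℤˣ) (L : CutDiagram n) :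
    L.weight K ε ⊗ₜ[K] (1 : Matrix (Fin 2) (Fin 2) K)
      = plainWeight (sl2Form ((ε : ℤ) : K)) (twistedQ K ε) L.partner := by
  -- `C` is diagonal, so only labellings constant on chords survive.
  have h0 : ∀ x ∉ chordLabellings L.partner,
      ∏ i ∈ L.chords, A1.formInv K ε (x i) (x (L.partner i)) = 0 := by
    intro x hx
    rw [mem_chordLabellings, not_forall] at hx
    obtain ⟨i, hi⟩ := hx
    rcases lt_or_gt_of_ne (L.partner_ne i) with h | h
    · refine Finset.prod_eq_zero (i := L.partner i) (by simpa [chords, L.partner_partner] using h) ?_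
      rw [formInv_apply, L.partner_partner, if_neg hi]
    · refine Finset.prod_eq_zero (i := i) (by simpa [chords] using h) ?_
      rw [formInv_apply, if_neg (Ne.symm hi)]
  rw [weight, plainWeight, ← Finset.sum_subset (Finset.subset_univ (chordLabellings L.partner))
    fun x _ hx => by rw [h0 x hx, zero_mul, zero_smul], TensorProduct.sum_tmul]
  refine Finset.sum_congr rfl fun x hx => ?_
  rw [mem_chordLabellings] at hx
  have h1 : ∏ i ∈ L.chords, A1.formInv K ε (x i) (x (L.partner i))
      = chordCoeff (sl2Form ((ε : ℤ) : K)) L.partner x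
        * ∏ i with i < L.partner i, twistSq K ε (x i) := by
    rw [chordCoeff, ← Finset.prod_mul_distrib]
    refine Finset.prod_congr rfl fun i _ => ?_
    rw [formInv_apply, hx, if_pos rfl]
  have h2 := prod_eq_crossings L.partner_partner L.partner_ne (twist K ε) (A1.commFactor K)
    (twistSq K ε) (twist_mul_twist ε) commFactor_mul_self (twist_mul_self ε) x hx
  have h3 : (List.ofFn fun i => twistedQ K ε (x i)).prod
      = (List.ofFn fun i => A1.Q K ε (x i)).prod ⊗ₜ[K] (List.ofFn fun i => twist K ε (x i)).prod :=
    prod_tmul _ _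
  rw [h3, h2, Algebra.algebraMap_eq_smul_one, TensorProduct.tmul_smul, smul_smul,
    ← TensorProduct.smul_tmul', h1, mul_assoc]
  rfl

/-- Over a field, tensoring with M₂(K) is faithful, so identities in U may be checked after ⊗ 1. -/
theorem tmul_one_injective {A : Type*} [Ring A] [Algebra K A] :
    Function.Injective fun a : A => a ⊗ₜ[K] (1 : Matrix (Fin 2) (Fin 2) K) :=
  Algebra.TensorProduct.includeLeft_injective (S := K) (algebraMap K _).injective

theorem CutDiagram.weight_eq_of_circleIso [CharZero K] {n : ℕ} (ε : ℤˣ) {L L' : CutDiagram n}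
    (h : CircleIso L L') : L.weight K ε = L'.weight K ε := by
  refine tmul_one_injective (K := K) ?_
  simp only [weight_tmul_one]
  exact plainWeight_eq_of_circleIso (isSl2Family_twistedQ ε) _ h

/-- The homomorphism `evalCY` of algebras. -/
noncomputable def evalCYHom (K : Type*) [Field K] (ε : ℤˣ) :
    MvPolynomial (Fin 2) K →ₐ[K] A1.Env K ε :=
  (Subalgebra.center K (A1.Env K ε)).val.comp
    (MvPolynomial.aeval ![A1.casimir K ε, A1.yElt K ε])

theorem evalCYHom_X_zero (ε : ℤˣ) :
    evalCYHom K ε (MvPolynomial.X 0) = A1.Q K ε 0 * A1.Q K ε 0 + (((ε : ℤ) : K) •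
      (A1.Q K ε 1 * A1.Q K ε 1) + A1.Q K ε 2 * A1.Q K ε 2 + A1.Q K ε 3 * A1.Q K ε 3) := by
  rw [← add_assoc, ← add_assoc, ← A1.casimirElt_eq]
  simp [evalCYHom, A1.casimir]

theorem evalCYHom_X_one (ε : ℤˣ) :
    evalCYHom K ε (MvPolynomial.X 1) = ((ε : ℤ) : K) •
      (A1.Q K ε 1 * A1.Q K ε 1) + A1.Q K ε 2 * A1.Q K ε 2 + A1.Q K ε 3 * A1.Q K ε 3 := by
  have h : evalCYHom K ε (MvPolynomial.X 1) = A1.casimirElt K ε - A1.Q K ε 0 ^ 2 := by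
    simp [evalCYHom, A1.casimir, A1.yElt]
  rw [h, A1.casimirElt_eq, sq, add_assoc, add_assoc, add_sub_cancel_left, add_assoc]

theorem Sl2Env.sl2Casimir_polyGen :
    sl2Casimir (polyGen K) = Polynomial.C (sl2Casimir (gen K)) := by
  simp [sl2Casimir, polyGen]

theorem Sl2Env.evalXC_X_one (η : K) : evalXC η (MvPolynomial.X 1)
    = η • sl2Casimir (polyGen K) := by
  rw [sl2Casimir_polyGen, Polynomial.smul_C]
  simp [evalXC, splitHom]

theorem Sl2Env.evalXC_X_zero (η : K) : evalXC η (MvPolynomial.X 0)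
    = polyGen K 0 * polyGen K 0 + evalXC η (MvPolynomial.X 1) := by
  simp [evalXC, splitHom, polyGen, sq]

/-- The squares 1, ε, -ε of the matrices and ε² = 1 turn ε times the sl₂ Casimir element into y. -/
theorem smul_sl2Casimir_tmul {A : Type*} [Ring A] [Algebra K A] (ε : ℤˣ) (J : Fin 4 → A) :
    ((ε : ℤ) : K) • sl2Casimir (fun a => J a ⊗ₜ[K] twist K ε a)
      = (((ε : ℤ) : K) • (J 1 * J 1) + J 2 * J 2 + J 3 * J 3) ⊗ₜ[K] 1 := by
  simp only [sl2Casimir, Algebra.TensorProduct.tmul_mul_tmul, twist_mul_self,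
    Algebra.algebraMap_eq_smul_one, TensorProduct.tmul_smul, TensorProduct.add_tmul, smul_add,
    smul_sub, smul_smul, ← TensorProduct.smul_tmul']
  simp [twistSq, A1.sign_sq]

/-- The homomorphism from the polynomials over the enveloping algebra of `sl₂` determined by an
`sl₂`-family. -/
theorem IsSl2Family.exists_polyLift {A : Type*} [Ring A] [Algebra K A] {J : Fin 4 → A}
    (hJ : IsSl2Family J) :
    ∃ φ : Polynomial (Sl2Env K) →ₐ[K] A, ∀ a, φ (Sl2Env.polyGen K a) = J a := by
  obtain ⟨ψ, hψ⟩ := hJ.exists_lift (K := K)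
  refine ⟨{ Polynomial.eval₂RingHom' ψ.toRingHom (J 0) fun a => (hJ.central (ψ a)).symm with
    commutes' := fun r => by simp [Polynomial.algebraMap_apply] }, fun a => ?_⟩
  fin_cases a
  · simp [Sl2Env.polyGen]
  · simpa [Sl2Env.polyGen] using hψ 1 (by decide)
  · simpa [Sl2Env.polyGen] using hψ 2 (by decide)
  · simpa [Sl2Env.polyGen] using hψ 3 (by decide)

/-- The bridge from the universal model to U: it respects both the generators and evaluation at (c,
y), the latter checked on the two variables. -/
theorem exists_polyLift_twistedQ (ε : ℤˣ) :
    ∃ φ : Polynomial (Sl2Env K) →ₐ[K] A1.Env K ε ⊗[K] Matrix (Fin 2) (Fin 2) K,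
      (∀ a, φ (Sl2Env.polyGen K a) = twistedQ K ε a) ∧
      ∀ P, φ (Sl2Env.evalXC ((ε : ℤ) : K) P) = A1.evalCY K ε P ⊗ₜ 1 := by
  obtain ⟨φ, hφ⟩ := (isSl2Family_twistedQ (K := K) ε).exists_polyLift (K := K)
  refine ⟨φ, hφ, fun P => ?_⟩
  have h1 : φ (((ε : ℤ) : K) • sl2Casimir (Sl2Env.polyGen K))
      = evalCYHom K ε (MvPolynomial.X 1) ⊗ₜ 1 := by
    rw [map_smul, evalCYHom_X_one]
    refine (congrArg _ (map_sl2Casimir (A := Polynomial (Sl2Env K))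
      (B := A1.Env K ε ⊗[K] Matrix (Fin 2) (Fin 2) K) φ fun a _ => hφ a)).trans ?_
    exact smul_sl2Casimir_tmul ε (A1.Q K ε)
  have h : φ.comp (Sl2Env.evalXC ((ε : ℤ) : K))
      = (Algebra.TensorProduct.includeLeft (S := K)).comp (evalCYHom K ε) := by
    refine MvPolynomial.algHom_ext fun i => ?_
    fin_cases i
    · change φ (Sl2Env.evalXC _ (MvPolynomial.X 0)) = evalCYHom K ε (MvPolynomial.X 0) ⊗ₜ 1
      rw [Sl2Env.evalXC_X_zero, Sl2Env.evalXC_X_one, evalCYHom_X_zero, ← evalCYHom_X_one, map_add,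
        h1, map_mul, hφ, TensorProduct.add_tmul]
      simp [twistedQ, twist]
    · change φ (Sl2Env.evalXC _ (MvPolynomial.X 1)) = evalCYHom K ε (MvPolynomial.X 1) ⊗ₜ 1
      rw [Sl2Env.evalXC_X_one, h1]
  exact DFunLike.congr_fun h P

/-- The twist of an `sl₂`-family satisfies the relations of `A1_ε`. -/
theorem IsSl2Family.exists_envLift {A : Type*} [Ring A] [Algebra K A] {J : Fin 4 → A}
    (hJ : IsSl2Family J) (ε : ℤˣ) :
    ∃ χ : A1.Env K ε →ₐ[K] A ⊗[K] Matrix (Fin 2) (Fin 2) K,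
      ∀ a, χ (A1.Q K ε a) = J a ⊗ₜ twist K ε a := by
  refine ⟨RingQuot.liftAlgHom K ⟨FreeAlgebra.lift K fun a => J a ⊗ₜ twist K ε a, ?_⟩, fun a => ?_⟩
  · rintro _ _ ⟨a, b⟩
    -- Twisting works both ways: ordinary commutators of the J's become graded brackets of the J_a ⊗
    -- t_a.
    have h : (J a ⊗ₜ[K] twist K ε a) * (J b ⊗ₜ[K] twist K ε b)
        = A1.commFactor K a b • ((J b ⊗ₜ[K] twist K ε b) * (J a ⊗ₜ[K] twist K ε a))
          + (J a * J b - J b * J a) ⊗ₜ[K] (twist K ε a * twist K ε b) := by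
      rw [Algebra.TensorProduct.tmul_mul_tmul, Algebra.TensorProduct.tmul_mul_tmul,
        ← TensorProduct.tmul_smul, ← twist_mul_twist, ← TensorProduct.add_tmul, add_sub_cancel]
    simp only [map_mul, map_add, map_smul, map_sum, FreeAlgebra.lift_ι_apply, h, hJ.commutators]
    congr 1
    obtain ⟨⟨h12, h21⟩, ⟨h23, h32⟩, ⟨h31, h13⟩⟩ := twist_products (K := K) ε
    rw [Fin.sum_univ_four]
    fin_cases a <;> fin_cases b <;> simp [A1.structConst, h12, h21, h23, h32, h31, h13,
      TensorProduct.neg_tmul, TensorProduct.tmul_neg, TensorProduct.tmul_smul]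
  · simp [A1.Q]

theorem smul_sl2Casimir {A : Type*} [Ring A] [Algebra K A] (r : K) (J : Fin 4 → A) :
    r • sl2Casimir J = r • (J 1 * J 1) + r • (J 2 * J 2) + (-r) • (J 3 * J 3) := by
  rw [sl2Casimir, smul_sub, smul_add, neg_smul, sub_eq_add_neg]

/-- The elements `c` and `y` are algebraically independent. -/
theorem evalCY_injective [CharZero K] (ε : ℤˣ) : Function.Injective (A1.evalCY K ε) := by
  have hη : ((ε : ℤ) : K) ≠ 0 := left_ne_zero_of_mul_eq_one (A1.sign_sq K ε)
  obtain ⟨χ, hχ⟩ := (Sl2Env.isSl2Family_polyGen (K := K)).exists_envLift (K := K) ε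
  have h1 : χ (evalCYHom K ε (MvPolynomial.X 1))
      = Sl2Env.evalXC ((ε : ℤ) : K) (MvPolynomial.X 1) ⊗ₜ 1 := by
    rw [evalCYHom_X_one, Sl2Env.evalXC_X_one]
    rw [smul_sl2Casimir]
    simp only [map_add, map_mul, map_smul, hχ, Algebra.TensorProduct.tmul_mul_tmul, twist_mul_self,
      Algebra.algebraMap_eq_smul_one, TensorProduct.tmul_smul, TensorProduct.add_tmul,
      ← TensorProduct.smul_tmul']
    simp [twistSq]
  -- χ carries evaluation at (c, y) to `evalXC`, already known to be injective.
  have h : χ.comp (evalCYHom K ε) = (Algebra.TensorProduct.includeLeft (S := K)).comp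
      (Sl2Env.evalXC ((ε : ℤ) : K)) := by
    refine MvPolynomial.algHom_ext fun i => ?_
    fin_cases i
    · change χ (evalCYHom K ε (MvPolynomial.X 0)) = Sl2Env.evalXC _ (MvPolynomial.X 0) ⊗ₜ 1
      rw [Sl2Env.evalXC_X_zero, evalCYHom_X_zero, ← evalCYHom_X_one, map_add,
        h1, map_mul, hχ, TensorProduct.add_tmul]
      simp [twist]
    · exact h1
  intro P P' hP
  refine Sl2Env.evalXC_injective hη (tmul_one_injective (K := K) ?_)
  have e := fun P => DFunLike.congr_fun h P
  exact (e P).symm.trans ((congrArg χ hP).trans (e P'))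

theorem ChordDiagram.weight_close [CharZero K] {n : ℕ} (ε : ℤˣ) (L : CutDiagram n) :
    L.close.weight K ε = L.weight K ε :=
  CutDiagram.weight_eq_of_circleIso ε (Quotient.exact (Quotient.out_eq L.close))

theorem ChordDiagram.weightLin_s_close [CharZero K] {n : ℕ} (ε : ℤˣ) (L : CutDiagram n) :
    weightLin K ε (L.close.s K) = ∑ i ∈ L.chords, (L.delete i).weight K ε := by
  change weightLin K ε (L.removeSum K) = _
  simp [weightLin, CutDiagram.removeSum, map_sum, weight_close]

end

/-! ### Conclusion. -/

theorem mainTheorem4 {K : Type*} [Field K] [CharZero K] (ε : ℤˣ) {n : ℕ} (D : ChordDiagram n) :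
    (∀ L : CutDiagram n, L.close = D → L.weight K ε = D.weight K ε) ∧
    (∃! P : MvPolynomial (Fin 2) K, A1.evalCY K ε P = D.weight K ε) ∧
    ∀ P : MvPolynomial (Fin 2) K, A1.evalCY K ε P = D.weight K ε →
      A1.evalCY K ε (MvPolynomial.pderiv 0 P) = ChordDiagram.weightLin K ε (D.s K) := by
  obtain ⟨L, rfl⟩ : ∃ L : CutDiagram n, L.close = D := Quotient.exists_rep D
  have hη : ((ε : ℤ) : K) ≠ 0 := left_ne_zero_of_mul_eq_one (A1.sign_sq K ε)
  obtain ⟨φ, hφ, hP⟩ := exists_polyLift_twistedQ (K := K) ε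
  have hW : ∀ {m : ℕ} (L : CutDiagram m),
      φ (plainWeight (sl2Form ((ε : ℤ) : K)) (Sl2Env.polyGen K) L.partner)
        = L.weight K ε ⊗ₜ[K] 1 := fun L => by
    refine (map_plainWeight (A := Polynomial (Sl2Env K))
      (A' := TensorProduct K (A1.Env K ε) (Matrix (Fin 2) (Fin 2) K)) φ).trans ?_
    rw [CutDiagram.weight_tmul_one]
    simp only [hφ]
  -- The polynomial is found in U(sl₂)[X] and transported by φ; by injectivity of `A1.evalCY` it is
  -- the only candidate, so the derivative formula is needed for it alone.
  obtain ⟨P₀, hP₀⟩ := L.exists_evalXC_eq hη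
  have h₀ : A1.evalCY K ε P₀ = L.weight K ε := by
    refine tmul_one_injective (K := K) ?_
    simp only
    rw [← hP, hP₀, hW]
  rw [ChordDiagram.weight_close, ChordDiagram.weightLin_s_close]
  refine ⟨fun L' h => ?_, ⟨P₀, h₀, fun P h => evalCY_injective ε (h.trans h₀.symm)⟩, fun P h => ?_⟩
  · rw [← ChordDiagram.weight_close, h, ChordDiagram.weight_close]
  · obtain rfl : P = P₀ := evalCY_injective ε (h.trans h₀.symm)
    refine tmul_one_injective (K := K) ?_
    simp only
    rw [← hP, L.evalXC_pderiv _ P hP₀, map_sum, TensorProduct.sum_tmul]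
    exact Finset.sum_congr rfl fun i _ => hW _
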